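/- Let $V$ be a finite dimensional complex vector space, $G$ a finite subgroup of $GL(V)$ and $\kappa : V\times V\to \mathbb{C}G$ a skew-symmetric bilinear map. Let $G$ act on the tensor algebra $T(V)$ and on the symmetric algebra $S(V)$ by the algebra automorphisms extending its action on $V$, let $T(V)\ast G$ and $S(V)\ast G$ be the skew group algebras, and put \[A=\big(T(V)\ast G\big)/\langle vw-wv-\kappa(v,w) : v,w\in V\rangle .\] Filter $A$ by $F^0=\mathbb{C}G$, $F^1=\mathbb{C}G+V\,\mathbb{C}G$, $F^i=(F^1)^i$ for $i>1$ (images in $A$; $F^{-1}=0$), and let $\operatorname{gr}A=\bigoplus_{i\ge 0}F^i/F^{i-1}$. The algebra $A$ is called a \emph{graded Hecke algebra} if $S(V)\ast G\cong\operatorname{gr}A$ as graded $\mathbb{C}$-algebras, where $S(V)\ast G$ is graded with degree $n$ component $S^n(V)\otimes\mathbb{C}G$. If $A$ is a graded Hecke algebra, then $A$ is (left and right) noetherian, $A$ is a prime ring, and $A$ has finite (left and right) global dimension. -/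

import Mathlib

open scoped DirectSum

universe u

noncomputable section

/-! ### Ring-theoretic notions -/

/-- A (not necessarily commutative) ring is prime if it is nonzero and `a R b = 0` forces
`a = 0` or `b = 0`; equivalently, the product of two nonzero two-sided ideals is nonzero. -/
structure IsPrimeRing (R : Type*) [Ring R] : Prop where
  nontrivial : Nontrivial R
  eq_zero_or_eq_zero : ∀ a b : R, (∀ r : R, a * r * b = 0) → a = 0 ∨ b = 0

/-- Two-sided noetherian: noetherian as a left module and as a right module over itself. -/
def IsTwoSidedNoetherian (R : Type*) [Ring R] : Prop :=
  IsNoetherianRing R ∧ IsNoetherianRing Rᵐᵒᵖ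

/-- The left global dimension of `R` is at most `n`: every left `R`-module has projective
dimension at most `n`. -/
def LeftGlobalDimensionLE (R : Type u) [Ring R] (n : ℕ) : Prop :=
  ∀ M : ModuleCat.{u} R, CategoryTheory.HasProjectiveDimensionLE M n

/-- The left and the right global dimension of `R` are finite
(right modules are left modules over the opposite ring). -/
def HasFiniteGlobalDimension (R : Type*) [Ring R] : Prop :=
  ∃ n : ℕ, LeftGlobalDimensionLE R n ∧ LeftGlobalDimensionLE Rᵐᵒᵖ n

/-! ### Positively filtered algebras and their associated graded algebras -/

/-- A positive algebra filtration `F 0 ≤ F 1 ≤ F 2 ≤ ⋯` on a `k`-algebra `A`. -/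
structure AlgFiltration (k A : Type*) [CommRing k] [Ring A] [Algebra k A] where
  F : ℕ → Submodule k A
  mono : Monotone F
  one_mem : (1 : A) ∈ F 0
  mul_mem : ∀ {i j : ℕ} {a b : A}, a ∈ F i → b ∈ F j → a * b ∈ F (i + j)

namespace AlgFiltration

variable {k A : Type*} [CommRing k] [Ring A] [Algebra k A] (𝓕 : AlgFiltration k A)

/-- The previous filtration step: `prev n = F (n - 1)`, with `F (-1) = 0`. -/
def prev : ℕ → Submodule k A
  | 0 => ⊥
  | n + 1 => 𝓕.F n

lemma mul_mem_prev_left {i j : ℕ} {a b : A} (ha : a ∈ 𝓕.prev i) (hb : b ∈ 𝓕.F j) :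
    a * b ∈ 𝓕.prev (i + j) := by
  cases i with
  | zero =>
    have h0 : a = 0 := ha
    simp [h0]
  | succ n =>
    rw [show n + 1 + j = (n + j) + 1 by omega]
    exact 𝓕.mul_mem (i := n) ha hb

lemma mul_mem_prev_right {i j : ℕ} {a b : A} (ha : a ∈ 𝓕.F i) (hb : b ∈ 𝓕.prev j) :
    a * b ∈ 𝓕.prev (i + j) := by
  cases j with
  | zero =>
    have h0 : b = 0 := hb
    simp [h0]
  | succ n => exact 𝓕.mul_mem (j := n) ha hb

/-- The degree `n` component `F n / F (n - 1)` of the associated graded algebra. -/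
def Piece (n : ℕ) : Type _ := 𝓕.F n ⧸ (𝓕.prev n).submoduleOf (𝓕.F n)

instance (n : ℕ) : AddCommGroup (𝓕.Piece n) :=
  inferInstanceAs (AddCommGroup (𝓕.F n ⧸ (𝓕.prev n).submoduleOf (𝓕.F n)))

instance (n : ℕ) : Module k (𝓕.Piece n) :=
  inferInstanceAs (Module k (𝓕.F n ⧸ (𝓕.prev n).submoduleOf (𝓕.F n)))

/-- The class in `F n / F (n - 1)` of an element of `F n`. -/
def cls {n : ℕ} (a : A) (ha : a ∈ 𝓕.F n) : 𝓕.Piece n := Submodule.Quotient.mk ⟨a, ha⟩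

variable {𝓕}

lemma cls_eq {n : ℕ} {a b : A} {ha : a ∈ 𝓕.F n} {hb : b ∈ 𝓕.F n}
    (h : a - b ∈ 𝓕.prev n) : 𝓕.cls a ha = 𝓕.cls b hb :=
  (Submodule.Quotient.eq _).2 h

lemma exists_cls {n : ℕ} (x : 𝓕.Piece n) : ∃ a, ∃ ha : a ∈ 𝓕.F n, x = 𝓕.cls a ha := by
  obtain ⟨⟨a, ha⟩, rfl⟩ := Submodule.Quotient.mk_surjective _ x
  exact ⟨a, ha, rfl⟩

variable (𝓕)

/-- The product `(a + F (i-1)) * (b + F (j-1)) = a * b + F (i+j-1)` of homogeneous components. -/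
def pieceMul {i j : ℕ} (x : 𝓕.Piece i) (y : 𝓕.Piece j) : 𝓕.Piece (i + j) :=
  Quotient.liftOn₂ x y (fun a b => 𝓕.cls (a.1 * b.1) (𝓕.mul_mem a.2 b.2))
    (by
      intro a b a' b' h h'
      have h1 : (a : A) - a' ∈ 𝓕.prev i := (Submodule.quotientRel_def (𝓕.prev i |>.submoduleOf (𝓕.F i))).1 h
      have h2 : (b : A) - b' ∈ 𝓕.prev j := (Submodule.quotientRel_def (𝓕.prev j |>.submoduleOf (𝓕.F j))).1 h'
      apply cls_eq
      have e : (a : A) * b - a' * b' = (a - a') * b + a' * (b - b') := by noncomm_ring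
      rw [e]
      exact add_mem (𝓕.mul_mem_prev_left h1 b.2) (𝓕.mul_mem_prev_right a'.2 h2))

variable {𝓕}

@[simp] lemma pieceMul_cls {i j : ℕ} {a b : A} (ha : a ∈ 𝓕.F i) (hb : b ∈ 𝓕.F j) :
    𝓕.pieceMul (𝓕.cls a ha) (𝓕.cls b hb) = 𝓕.cls (a * b) (𝓕.mul_mem ha hb) := rfl

lemma cls_add {n : ℕ} {a b : A} (ha : a ∈ 𝓕.F n) (hb : b ∈ 𝓕.F n) :
    𝓕.cls a ha + 𝓕.cls b hb = 𝓕.cls (a + b) (add_mem ha hb) := rfl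

lemma smul_cls {n : ℕ} (c : k) {a : A} (ha : a ∈ 𝓕.F n) :
    c • 𝓕.cls a ha = 𝓕.cls (c • a) (Submodule.smul_mem _ c ha) := rfl

lemma cls_zero {n : ℕ} : 𝓕.cls (0 : A) (zero_mem (𝓕.F n)) = 0 := rfl

lemma gradedMk_cls_eq {i j : ℕ} (hij : i = j) {a b : A} (hab : a = b) (ha : a ∈ 𝓕.F i)
    (hb : b ∈ 𝓕.F j) :
    (GradedMonoid.mk i (𝓕.cls a ha) : GradedMonoid 𝓕.Piece) =
      GradedMonoid.mk j (𝓕.cls b hb) := by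
  subst hij; subst hab; rfl

instance : GradedMonoid.GMul 𝓕.Piece where
  mul := 𝓕.pieceMul

instance : GradedMonoid.GOne 𝓕.Piece where
  one := 𝓕.cls 1 𝓕.one_mem

instance : GradedMonoid.GMonoid 𝓕.Piece where
  one_mul := by
    rintro ⟨i, x⟩
    obtain ⟨a, ha, rfl⟩ := exists_cls x
    exact gradedMk_cls_eq (zero_add i) (one_mul a) _ _
  mul_one := by
    rintro ⟨i, x⟩
    obtain ⟨a, ha, rfl⟩ := exists_cls x
    exact gradedMk_cls_eq (add_zero i) (mul_one a) _ _
  mul_assoc := by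
    rintro ⟨i, x⟩ ⟨j, y⟩ ⟨l, z⟩
    obtain ⟨a, ha, rfl⟩ := exists_cls x
    obtain ⟨b, hb, rfl⟩ := exists_cls y
    obtain ⟨c, hc, rfl⟩ := exists_cls z
    exact gradedMk_cls_eq (add_assoc i j l) (mul_assoc a b c) _ _

lemma gMul_def {i j : ℕ} (x : 𝓕.Piece i) (y : 𝓕.Piece j) :
    GradedMonoid.GMul.mul x y = 𝓕.pieceMul x y := rfl

lemma natCast_mem (n : ℕ) : (n : A) ∈ 𝓕.F 0 := by
  have h := nsmul_mem 𝓕.one_mem n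
  rwa [nsmul_one] at h

lemma intCast_mem (n : ℤ) : (n : A) ∈ 𝓕.F 0 := by
  have h := zsmul_mem 𝓕.one_mem n
  rwa [zsmul_one] at h

lemma algebraMap_mem (c : k) : algebraMap k A c ∈ 𝓕.F 0 := by
  rw [Algebra.algebraMap_eq_smul_one]
  exact Submodule.smul_mem _ c 𝓕.one_mem

lemma cls_congr {n : ℕ} {a b : A} (hab : a = b) (ha : a ∈ 𝓕.F n) (hb : b ∈ 𝓕.F n) :
    𝓕.cls a ha = 𝓕.cls b hb := by
  subst hab; rfl

instance : DirectSum.GRing 𝓕.Piece where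
  mul_zero := by
    intro i j x
    obtain ⟨a, ha, rfl⟩ := exists_cls x
    exact cls_congr (mul_zero a) _ _
  zero_mul := by
    intro i j x
    obtain ⟨a, ha, rfl⟩ := exists_cls x
    exact cls_congr (zero_mul a) _ _
  mul_add := by
    intro i j x y z
    obtain ⟨a, ha, rfl⟩ := exists_cls x
    obtain ⟨b, hb, rfl⟩ := exists_cls y
    obtain ⟨c, hc, rfl⟩ := exists_cls z
    exact cls_congr (mul_add a b c) _ _
  add_mul := by
    intro i j x y z
    obtain ⟨a, ha, rfl⟩ := exists_cls x
    obtain ⟨b, hb, rfl⟩ := exists_cls y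
    obtain ⟨c, hc, rfl⟩ := exists_cls z
    exact cls_congr (add_mul a b c) _ _
  natCast n := 𝓕.cls (n : A) (natCast_mem n)
  natCast_zero := cls_congr Nat.cast_zero _ (zero_mem (𝓕.F 0))
  natCast_succ n := cls_congr (Nat.cast_succ n) _ (add_mem (natCast_mem n) 𝓕.one_mem)
  intCast n := 𝓕.cls (n : A) (intCast_mem n)
  intCast_ofNat n := cls_congr (Int.cast_natCast n) _ _
  intCast_negSucc_ofNat n :=
    cls_congr (Int.cast_negSucc n) _ (neg_mem (natCast_mem (n + 1)))

instance : DirectSum.GAlgebra k 𝓕.Piece where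
  toFun :=
    { toFun := fun c => 𝓕.cls (algebraMap k A c) (algebraMap_mem c)
      map_zero' := cls_congr (map_zero _) _ (zero_mem _)
      map_add' := fun c d => cls_congr (map_add _ c d) _
        (add_mem (algebraMap_mem c) (algebraMap_mem d)) }
  map_one := cls_congr (map_one _) _ 𝓕.one_mem
  map_mul c d := gradedMk_cls_eq (zero_add 0).symm (map_mul _ c d) (algebraMap_mem _)
    (𝓕.mul_mem (algebraMap_mem c) (algebraMap_mem d))
  commutes := by
    rintro c ⟨i, x⟩
    obtain ⟨a, ha, rfl⟩ := exists_cls x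
    exact gradedMk_cls_eq ((zero_add i).trans (add_zero i).symm) (Algebra.commutes c a)
      (𝓕.mul_mem (algebraMap_mem c) ha) (𝓕.mul_mem ha (algebraMap_mem c))
  smul_def := by
    rintro c ⟨i, x⟩
    obtain ⟨a, ha, rfl⟩ := exists_cls x
    exact gradedMk_cls_eq (zero_add i).symm (Algebra.smul_def c a)
      (Submodule.smul_mem _ c ha) (𝓕.mul_mem (algebraMap_mem c) ha)

variable (𝓕)

/-- The associated graded algebra `gr A = ⨁ n, F n / F (n - 1)`, with its usual product. -/
abbrev Gr : Type _ := ⨁ n, 𝓕.Piece n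

/-- The homogeneous component of degree `n` of `gr A`. -/
def grComponent (n : ℕ) : Submodule k 𝓕.Gr := LinearMap.range (DirectSum.lof k ℕ 𝓕.Piece n)

end AlgFiltration

/-! ### Graded Hecke algebras -/

namespace GradedHecke

variable {V : Type*} [AddCommGroup V] [Module ℂ V]
  (G : Subgroup (LinearMap.GeneralLinearGroup ℂ V))

/-- The linear endomorphism of `V` given by an element of `G ≤ GL(V)`. -/
def toEnd : G →* Module.End ℂ V := (Units.coeHom (Module.End ℂ V)).comp G.subtype

/-- `G` acts on `T(V)` by algebra automorphisms extending the action on `V`. -/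
def tensorHom : G →* (TensorAlgebra ℂ V →ₐ[ℂ] TensorAlgebra ℂ V) where
  toFun g := TensorAlgebra.lift ℂ (TensorAlgebra.ι ℂ ∘ₗ toEnd G g)
  map_one' := by ext; simp
  map_mul' g h := by ext; simp

/-- `G` acts on `S(V)` by algebra automorphisms extending the action on `V`. -/
def symHom : G →* (SymmetricAlgebra ℂ V →ₐ[ℂ] SymmetricAlgebra ℂ V) where
  toFun g := SymmetricAlgebra.lift (SymmetricAlgebra.ι ℂ V ∘ₗ toEnd G g)
  map_one' := by ext; simp
  map_mul' g h := by ext; simp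

instance : MulSemiringAction G (TensorAlgebra ℂ V) where
  smul g x := tensorHom G g x
  one_smul x := by change tensorHom G 1 x = x; simp
  mul_smul g h x := by change tensorHom G (g * h) x = tensorHom G g (tensorHom G h x); simp
  smul_zero g := map_zero (tensorHom G g)
  smul_add g := map_add (tensorHom G g)
  smul_one g := map_one (tensorHom G g)
  smul_mul g := map_mul (tensorHom G g)

instance : MulSemiringAction G (SymmetricAlgebra ℂ V) where
  smul g x := symHom G g x
  one_smul x := by change symHom G 1 x = x; simp
  mul_smul g h x := by change symHom G (g * h) x = symHom G g (symHom G h x); simp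
  smul_zero g := map_zero (symHom G g)
  smul_add g := map_add (symHom G g)
  smul_one g := map_one (symHom G g)
  smul_mul g := map_mul (symHom G g)

instance : SMulCommClass G ℂ (TensorAlgebra ℂ V) where
  smul_comm g c x := map_smul (tensorHom G g) c x

instance : SMulCommClass G ℂ (SymmetricAlgebra ℂ V) where
  smul_comm g c x := map_smul (symHom G g) c x

/-- The skew group algebra `T(V) * G`; its product satisfies `(a g) (b h) = a (g • b) (g h)`. -/
abbrev TensorSkew : Type _ := SkewMonoidAlgebra (TensorAlgebra ℂ V) G

/-- The skew group algebra `S(V) * G`. -/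
abbrev SymSkew : Type _ := SkewMonoidAlgebra (SymmetricAlgebra ℂ V) G

/-- The degree `n` component `S^n(V) ⊗ ℂ G` of `S(V) * G`: the elements all of whose coefficients
lie in `S^n(V)`, the span of the products of `n` vectors. -/
def symComponent (n : ℕ) : Submodule ℂ (SymSkew G) where
  carrier := {f | ∀ g : G, f.coeff g ∈ (LinearMap.range (SymmetricAlgebra.ι ℂ V)) ^ n}
  zero_mem' g := by simp
  add_mem' ha hb g := by
    simpa using add_mem (ha g) (hb g)
  smul_mem' c f hf g := by
    simpa using Submodule.smul_mem _ c (hf g)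

variable {G}

/-- The inclusion `ℂ G → T(V) * G`. -/
def groupIncl : MonoidAlgebra ℂ G →ₐ[ℂ] TensorSkew G :=
  MonoidAlgebra.lift ℂ (TensorSkew G) G (SkewMonoidAlgebra.of (TensorAlgebra ℂ V) G)

/-- The inclusion `V → T(V) * G`. -/
def vecIncl : V →ₗ[ℂ] TensorSkew G :=
  SkewMonoidAlgebra.lsingle (R := ℂ) (1 : G) ∘ₗ TensorAlgebra.ι ℂ

/-- The relations `v w - w v = κ(v, w)` for `v, w ∈ V`. -/
inductive Rel (κ : V →ₗ[ℂ] V →ₗ[ℂ] MonoidAlgebra ℂ G) : TensorSkew G → TensorSkew G → Prop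
  | comm (v w : V) :
      Rel κ (vecIncl v * vecIncl w - vecIncl w * vecIncl v) (groupIncl (κ v w))

/-- The algebra `A = (T(V) * G) / ⟨[v, w] - κ(v, w) : v, w ∈ V⟩`. -/
abbrev Alg (κ : V →ₗ[ℂ] V →ₗ[ℂ] MonoidAlgebra ℂ G) : Type _ := RingQuot (Rel κ)

variable (κ : V →ₗ[ℂ] V →ₗ[ℂ] MonoidAlgebra ℂ G)

/-- The image of `ℂ G` in `A`. -/
def groupPart : Submodule ℂ (Alg κ) :=
  LinearMap.range ((RingQuot.mkAlgHom ℂ (Rel κ)).comp groupIncl).toLinearMap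

/-- The image of `V` in `A`. -/
def vecPart : Submodule ℂ (Alg κ) :=
  LinearMap.range ((RingQuot.mkAlgHom ℂ (Rel κ)).toLinearMap ∘ₗ vecIncl)

/-- `F 0 = ℂ G` and `F i = (ℂ G + V ℂ G) ^ i` for `i ≥ 1`. -/
def filtStep : ℕ → Submodule ℂ (Alg κ)
  | 0 => groupPart κ
  | n + 1 => (groupPart κ ⊔ vecPart κ * groupPart κ) ^ (n + 1)

lemma one_le_groupPart : 1 ≤ groupPart κ := by
  rw [Submodule.one_le]
  exact ⟨1, by simp⟩

lemma groupPart_mul_self : groupPart κ * groupPart κ = groupPart κ := by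
  apply le_antisymm
  · rw [Submodule.mul_le]
    rintro _ ⟨x, rfl⟩ _ ⟨y, rfl⟩
    exact ⟨x * y, by simp⟩
  · calc groupPart κ = 1 * groupPart κ := (one_mul _).symm
      _ ≤ groupPart κ * groupPart κ := mul_le_mul_left (one_le_groupPart κ) _

lemma smul_ι (g : G) (v : V) :
    g • TensorAlgebra.ι ℂ v = TensorAlgebra.ι ℂ (toEnd G g v) := by
  change tensorHom G g (TensorAlgebra.ι ℂ v) = _
  simp [tensorHom]

lemma of_mul_vecIncl (g : G) (v : V) :
    SkewMonoidAlgebra.of (TensorAlgebra ℂ V) G g * vecIncl v =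
      vecIncl (toEnd G g v) * SkewMonoidAlgebra.of (TensorAlgebra ℂ V) G g := by
  simp [vecIncl, SkewMonoidAlgebra.of, SkewMonoidAlgebra.lsingle,
    SkewMonoidAlgebra.single_mul_single, smul_ι]

lemma groupPart_mul_vecPart : groupPart κ * vecPart κ ≤ vecPart κ * groupPart κ := by
  rw [Submodule.mul_le]
  rintro _ ⟨x, rfl⟩ _ ⟨v, rfl⟩
  induction x using MonoidAlgebra.induction_on with
  | of g =>
    have h : (((RingQuot.mkAlgHom ℂ (Rel κ)).comp groupIncl).toLinearMap
          (MonoidAlgebra.of ℂ G g)) *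
        ((RingQuot.mkAlgHom ℂ (Rel κ)).toLinearMap ∘ₗ vecIncl) v =
        ((RingQuot.mkAlgHom ℂ (Rel κ)).toLinearMap ∘ₗ vecIncl) (toEnd G g v) *
        (((RingQuot.mkAlgHom ℂ (Rel κ)).comp groupIncl).toLinearMap
          (MonoidAlgebra.of ℂ G g)) := by
      have e := congrArg (RingQuot.mkAlgHom ℂ (Rel κ)) (of_mul_vecIncl g v)
      rw [map_mul, map_mul] at e
      simpa [groupIncl] using e
    rw [h]
    exact Submodule.mul_mem_mul ⟨_, rfl⟩ ⟨_, rfl⟩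
  | add x y hx hy =>
    rw [map_add, add_mul]
    exact add_mem hx hy
  | smul c x hx =>
    rw [map_smul, smul_mul_assoc]
    exact Submodule.smul_mem _ c hx

lemma groupPart_mul_filtStep_one :
    groupPart κ * (groupPart κ ⊔ vecPart κ * groupPart κ) ≤
      groupPart κ ⊔ vecPart κ * groupPart κ := by
  rw [Submodule.mul_sup, groupPart_mul_self, ← mul_assoc]
  refine sup_le_sup le_rfl ?_
  calc groupPart κ * vecPart κ * groupPart κ
      ≤ vecPart κ * groupPart κ * groupPart κ :=
        mul_le_mul_left (groupPart_mul_vecPart κ) _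
    _ = vecPart κ * groupPart κ := by rw [mul_assoc, groupPart_mul_self]

lemma filtStep_one_mul_groupPart :
    (groupPart κ ⊔ vecPart κ * groupPart κ) * groupPart κ =
      groupPart κ ⊔ vecPart κ * groupPart κ := by
  rw [Submodule.sup_mul, groupPart_mul_self, mul_assoc, groupPart_mul_self]

lemma filtStep_mul_le (i j : ℕ) :
    filtStep κ i * filtStep κ j ≤ filtStep κ (i + j) := by
  match i, j with
  | 0, 0 => exact (groupPart_mul_self κ).le
  | 0, n + 1 =>
    rw [zero_add]
    simp only [filtStep]
    rw [pow_succ', ← mul_assoc]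
    exact mul_le_mul_left (groupPart_mul_filtStep_one κ) _
  | n + 1, 0 =>
    simp only [filtStep]
    rw [pow_succ, mul_assoc, filtStep_one_mul_groupPart]
  | m + 1, n + 1 =>
    rw [show m + 1 + (n + 1) = (m + 1 + n) + 1 by omega]
    simp only [filtStep]
    rw [← pow_add]
    exact le_of_eq (by congr 1)

/-- The filtration of `A` with `F 0 = ℂ G`, `F 1 = ℂ G + V ℂ G` and `F i = (F 1) ^ i`. -/
def filtration : AlgFiltration ℂ (Alg κ) where
  F := filtStep κ
  mono := by
    refine monotone_nat_of_le_succ fun n => ?_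
    have h1 : (1 : Submodule ℂ (Alg κ)) ≤ filtStep κ 1 := by
      refine (one_le_groupPart κ).trans ?_
      simp only [filtStep, zero_add, pow_one]
      exact le_sup_left
    calc filtStep κ n = filtStep κ n * 1 := (mul_one _).symm
      _ ≤ filtStep κ n * filtStep κ 1 := mul_le_mul_right h1 _
      _ ≤ filtStep κ (n + 1) := filtStep_mul_le κ n 1
  one_mem := Submodule.one_le.1 (one_le_groupPart κ)
  mul_mem ha hb := filtStep_mul_le κ _ _ (Submodule.mul_mem_mul ha hb)

/-- `A` is a graded Hecke algebra if `S(V) * G` and `gr A` are isomorphic as graded algebras. -/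
def IsGradedHecke : Prop :=
  ∃ φ : SymSkew G ≃ₐ[ℂ] (filtration κ).Gr,
    ∀ n : ℕ, (symComponent G n).map φ.toLinearMap = (filtration κ).grComponent n

end GradedHecke

end

/-!
The three properties hold for `S(V) * G ≃ gr A` and pass from the associated graded ring `gr A` to
`A`. Right-hand statements are left-hand statements for the opposite ring, and `S(V) * G` is
isomorphic to its opposite by `a g ↦ g⁻¹ a` (`SkewMonoidAlgebra.opRingEquiv`), so only left modules
need to be treated.

*The skew group algebra.* `S(V) * G` is a finite module over the noetherian ring `S(V)`. It is prime
because `S(V)` is a domain on which `G` acts faithfully: an element of minimal support in a nonzero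
two-sided ideal lies, up to a group element, in `S(V)` (`SkewMonoidAlgebra.isPrimeRing`). Its global
dimension is at most `dim V`: by Maschke's averaging argument a module is projective over
`S(V) * G` when it is projective over `S(V)`
(`SkewMonoidAlgebra.projective_of_projective_coeff`), and Hilbert's syzygy theorem bounds projective
dimensions over `S(V)`. The latter is proved one variable at a time from the exact sequence
`0 → N[X] → N[X] → N → 0` for an `R[X]`-module `N`. Both steps use the change of rings lemma
`LeftGlobalDimensionLE.of_restrictScalars`.

*From `gr A` to `A`.* A filtered object together with a model of its associated graded object is
encoded by `FiltSymbol`, `RingSymbol` and `ModuleSymbol`. Noetherianity follows since nested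
submodules with the same associated graded submodule agree, and primeness since the product of
leading symbols is the symbol of the product. For global dimension, every `A`-module `M` has the
filtration with `F i M = M` for all `i ≥ 0`, so it suffices that a filtered module has projective
dimension at most that of its associated graded module (`ModuleSymbol.projDimLE`). By dimension
shifting along a free filtered cover `Q → M` this reduces to the case of a projective associated
graded module (`ModuleSymbol.projective`). There the component of degree zero of a splitting of
`gr Q → gr M` lifts to an endomorphism `f` of `Q` over `M` which lowers the filtration on the kernel
of `Q → M`. Hence the powers of `f` stabilise on each element, and their limit factors through `M`
and splits `Q → M`.
-/

universe v w

/-! ### Projective dimension and change of rings -/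

section ProjectiveDimension

open CategoryTheory

/-- The `R`-module `M` has projective dimension at most `n`. -/
abbrev ProjDimLE (R : Type u) [Ring R] (M : Type v) [AddCommGroup M] [Module R M] (n : ℕ) : Prop :=
  HasProjectiveDimensionLE (ModuleCat.of R M) n

section ProjDim

variable {R : Type u} [Ring R]

lemma projDimLE_zero_iff [Small.{v} R] {M : Type v} [AddCommGroup M] [Module R M] :
    ProjDimLE R M 0 ↔ Module.Projective R M := by
  unfold ProjDimLE
  rw [← projective_iff_hasProjectiveDimensionLE_zero]
  exact (IsProjective.iff_projective (R := R) M).symm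

lemma projDimLE_of_projective {M : Type v} [AddCommGroup M] [Module R M]
    [Module.Projective R M] (n : ℕ) : ProjDimLE R M n := by
  have := ModuleCat.projective_of_categoryTheory_projective (ModuleCat.of R M)
  unfold ProjDimLE HasProjectiveDimensionLE
  infer_instance

lemma ProjDimLE.mono {M : Type v} [AddCommGroup M] [Module R M] {m n : ℕ}
    (h : ProjDimLE R M m) (hmn : m ≤ n) : ProjDimLE R M n :=
  hasProjectiveDimensionLT_of_ge (ModuleCat.of R M) (m + 1) (n + 1) (by omega)

/-- Dimension shifting. -/
lemma projDimLE_succ_iff {P M : Type v} [AddCommGroup P] [Module R P] [AddCommGroup M]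
    [Module R M] [Module.Projective R P] (f : P →ₗ[R] M) (hf : Function.Surjective f) (n : ℕ) :
    ProjDimLE R M (n + 1) ↔ ProjDimLE R (LinearMap.ker f) n :=
  (LinearMap.shortExact_shortComplexKer hf).hasProjectiveDimensionLT_X₃_iff n
    (ModuleCat.projective_of_categoryTheory_projective (ModuleCat.of R P))

end ProjDim

section Transfer

variable {R : Type w} {S : Type v} [Ring R] [Ring S] [Module R S] [IsScalarTower R S S]

/-- Change of rings: if `S` is projective over `R` and every `R`-projective `S`-module has
projective dimension at most `c`, then passing from `R` to `S` raises projective dimensions by at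
most `c`. -/
theorem ProjDimLE.of_restrictScalars [Small.{v} R] [Module.Projective R S] {c : ℕ}
    (h0 : ∀ (M : Type v) [AddCommGroup M] [Module R M] [Module S M] [IsScalarTower R S M],
      Module.Projective R M → ProjDimLE S M c) (n : ℕ) :
    ∀ (M : Type v) [AddCommGroup M] [Module R M] [Module S M] [IsScalarTower R S M],
      ProjDimLE R M n → ProjDimLE S M (n + c) := by
  induction n with
  | zero =>
    intro M _ _ _ _ h
    rw [zero_add]
    exact h0 M (projDimLE_zero_iff.1 h)
  | succ n ih =>
    intro M _ _ _ _ h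
    let f : (M →₀ S) →ₗ[S] M := Finsupp.linearCombination S id
    have hf : Function.Surjective f := Finsupp.linearCombination_id_surjective S M
    rw [show n + 1 + c = n + c + 1 by omega, projDimLE_succ_iff f hf]
    have : IsScalarTower R S (M →₀ S) := ⟨fun r s x => by ext; simp⟩
    have : IsScalarTower R S (LinearMap.ker f) := ⟨fun r s x => Subtype.ext (smul_assoc r s x.1)⟩
    have : Module.Projective R (M →₀ S) := by
      classical exact Module.Projective.of_equiv (finsuppLequivDFinsupp (ι := M) (M := S) R).symm
    apply ih
    exact (projDimLE_succ_iff (f.restrictScalars R) hf n).1 h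

end Transfer

theorem LeftGlobalDimensionLE.projDimLE {R : Type u} [Ring R] {n : ℕ}
    (h : LeftGlobalDimensionLE R n) (M : Type u) [AddCommGroup M] [Module R M] :
    ProjDimLE R M n := h (ModuleCat.of R M)

/-- Change of rings for global dimensions. -/
theorem LeftGlobalDimensionLE.of_restrictScalars {R S : Type u} [Ring R] [Ring S] [Module R S]
    [IsScalarTower R S S] [Module.Projective R S] {c n : ℕ}
    (h0 : ∀ (M : Type u) [AddCommGroup M] [Module R M] [Module S M] [IsScalarTower R S M],
      Module.Projective R M → ProjDimLE S M c)
    (hR : LeftGlobalDimensionLE R n) : LeftGlobalDimensionLE S (n + c) := by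
  intro M
  let f : R →+* S :=
    { toFun := fun r => r • 1
      map_one' := one_smul _ _
      map_mul' := fun r s => by rw [smul_mul_assoc, one_mul, mul_smul]
      map_zero' := zero_smul _ _
      map_add' := fun r s => add_smul _ _ _ }
  let _ : Module R M := Module.compHom M f
  have : IsScalarTower R S M := ⟨fun r s m => by
    change (r • s) • m = (r • (1 : S)) • s • m
    rw [← mul_smul, smul_mul_assoc, one_mul]⟩
  exact ProjDimLE.of_restrictScalars h0 n M (hR.projDimLE M)

theorem LeftGlobalDimensionLE.of_ringEquiv {R S : Type u} [Ring R] [Ring S] (e : R ≃+* S) {n : ℕ}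
    (hR : LeftGlobalDimensionLE R n) : LeftGlobalDimensionLE S n := by
  let _ : Module R S := Module.compHom S e.toRingHom
  have hsmul (r : R) (s : S) : r • s = e r * s := rfl
  have : IsScalarTower R S S := ⟨fun r s t => by simp only [hsmul, smul_eq_mul, mul_assoc]⟩
  let e' : S ≃ₗ[R] R :=
    { e.symm.toAddEquiv with
      map_smul' := fun r s => by simp [hsmul] }
  have : Module.Projective R S := Module.Projective.of_equiv e'.symm
  refine LeftGlobalDimensionLE.of_restrictScalars (R := R) (c := 0) ?_ hR
  intro M _ _ _ hM hP
  have hs (s : S) (m : M) : e.symm s • m = s • m := by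
    rw [← one_smul S m, ← smul_assoc, hsmul]
    simp
  rw [projDimLE_zero_iff]
  obtain ⟨g, hg⟩ := Module.projective_def'.1 hP
  -- the coefficients of a splitting over `R`, transported along `e`, give a splitting over `S`
  let g' : M →ₗ[S] (M →₀ S) :=
    { toFun := fun m => (g m).mapRange e (map_zero e)
      map_add' := fun a b => by ext; simp
      map_smul' := fun s m => by
        ext i
        simp [← hs] }
  refine Module.Projective.of_split g' (Finsupp.linearCombination S id) ?_
  ext m
  have h1 := LinearMap.congr_fun hg m
  simp only [LinearMap.comp_apply, LinearMap.id_apply, Finsupp.linearCombination_apply] at h1 ⊢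
  conv_rhs => rw [← h1]
  rw [show g' m = (g m).mapRange e (map_zero e) from rfl, Finsupp.sum_mapRange_index (by simp)]
  refine Finsupp.sum_congr fun i _ => ?_
  rw [← hs]; simp

lemma HasFiniteGlobalDimension.of_le {R : Type u} [Ring R] {m n : ℕ}
    (hm : LeftGlobalDimensionLE R m) (hn : LeftGlobalDimensionLE Rᵐᵒᵖ n) :
    HasFiniteGlobalDimension R :=
  ⟨max m n, fun M => (hm.projDimLE M).mono (le_max_left m n),
    fun M => (hn.projDimLE M).mono (le_max_right m n)⟩

end ProjectiveDimension

/-! ### Hilbert's syzygy theorem -/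

section Hilbert

open Polynomial

namespace PolynomialModule

variable {R : Type*} [CommRing R] {N : Type*} [AddCommGroup N] [Module R N]

lemma single_eq_X_pow_smul (i : ℕ) (m : N) :
    single R i m = (X ^ i : R[X]) • single R 0 m := by
  rw [← monomial_one_right_eq_X_pow, monomial_smul_single]
  simp

variable [Module R[X] N] [IsScalarTower R R[X] N]

variable (N) in

/-- Multiplication by `X` on an `R[X]`-module `N`, as an `R`-linear map. -/
noncomputable def mulX : N →ₗ[R] N := (LinearMap.lsmul R[X] N X).restrictScalars R

variable (N) in
/-- The `R[X]`-linear map `X ⊗ 1 - 1 ⊗ X` on `N[X] = R[X] ⊗ N`. -/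
noncomputable def koszulDiff : PolynomialModule R N →ₗ[R[X]] PolynomialModule R N where
  toFun q := (X : R[X]) • q - map R (mulX N) q
  map_add' p q := by rw [smul_add, map_add]; abel
  map_smul' a q := by
    rw [PolynomialModule.map_smul, smul_sub, smul_comm, Algebra.algebraMap_self, Polynomial.map_id]
    rfl

variable (N) in
/-- The `R[X]`-linear map `R[X] ⊗ N → N` given by the action. -/
noncomputable def action : PolynomialModule R N →ₗ[R[X]] N :=
  (LinearMap.liftBaseChange R[X] (LinearMap.id : N →ₗ[R] N)) ∘ₗ
    (polynomialTensorProductLEquivPolynomialModule R N).symm.toLinearMap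

lemma action_single_zero (m : N) : action N (single R 0 m) = m := by
  have h : (polynomialTensorProductLEquivPolynomialModule R N).symm (single R 0 m) =
      TensorProduct.tmul R 1 m := by
    rw [LinearEquiv.symm_apply_eq]
    simp [polynomialTensorProductLEquivPolynomialModule, lsingle]
  simp [action, h]

lemma action_surjective : Function.Surjective (action (R := R) N) :=
  fun m => ⟨single R 0 m, action_single_zero m⟩

lemma koszulDiff_single (i : ℕ) (m : N) : koszulDiff N (single R i m) =
    single R (i + 1) m - single R i ((X : R[X]) • m) := by
  change (X : R[X]) • single R i m - map R (mulX N) (single R i m) = _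
  rw [map_single, ← monomial_one_one_eq_X, monomial_smul_single,
    monomial_one_one_eq_X]
  simp [add_comm, mulX]

lemma coeff_koszulDiff_succ (q : PolynomialModule R N) (k : ℕ) :
    (koszulDiff N q).coeff (k + 1) = q.coeff k - (X : R[X]) • q.coeff (k + 1) := by
  induction q using induction_linear with
  | zero => simp
  | add p q hp hq => simp only [map_add, coeff_add, Finsupp.add_apply, hp, hq, smul_add]; abel
  | single i m =>
    rw [koszulDiff_single]
    have hsub (a b : PolynomialModule R N) : (a - b).coeff = a.coeff - b.coeff :=
      map_sub (coeffAddEquiv : PolynomialModule R N ≃+ (ℕ →₀ N)) a b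
    simp only [hsub, coeff_single, Finsupp.sub_apply, Finsupp.single_apply]
    split_ifs <;> simp_all

/-- The coefficients of an element of the kernel satisfy `qₖ = X qₖ₊₁`, and almost all of them
vanish. -/
lemma koszulDiff_injective : Function.Injective (koszulDiff (R := R) N) := by
  rw [injective_iff_map_eq_zero]
  intro q hq
  have h (k : ℕ) : q.coeff k = (X : R[X]) • q.coeff (k + 1) := by
    have := coeff_koszulDiff_succ q k
    rw [hq] at this
    simpa [sub_eq_zero] using this.symm
  have h' (k j : ℕ) : q.coeff k = (X ^ j : R[X]) • q.coeff (k + j) := by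
    induction j with
    | zero => simp
    | succ j ih => rw [ih, h (k + j), smul_smul, pow_succ, add_assoc]
  rw [← coeff_eq_zero]
  ext k
  obtain ⟨n, hn⟩ := q.coeff.support.exists_nat_subset_range
  rw [h' k n]
  have : q.coeff (k + n) = 0 := by
    by_contra hne
    have := hn (Finsupp.mem_support_iff.2 hne)
    simp at this
  simp [this]

/-- Modulo the image of `koszulDiff`, `X` acts on `N[X]` through the coefficients, so every element
is congruent to a constant. -/
lemma sub_single_action_mem_range (q : PolynomialModule R N) :
    q - single R 0 (action N q) ∈ LinearMap.range (koszulDiff (R := R) N) := by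
  induction q using induction_linear with
  | zero => simp
  | add p q hp hq =>
    rw [map_add, single_add, add_sub_add_comm]
    exact add_mem hp hq
  | single i m =>
    rw [single_eq_X_pow_smul, LinearMap.map_smul, action_single_zero, ← single_eq_X_pow_smul]
    induction i generalizing m with
    | zero => simp
    | succ i ih =>
      have h := add_mem (ih ((X : R[X]) • m))
        (LinearMap.mem_range_self (koszulDiff N) (single R i m))
      rw [koszulDiff_single] at h
      convert h using 1
      rw [pow_succ, mul_smul]
      abel

lemma ker_action : LinearMap.ker (action (R := R) N) = LinearMap.range (koszulDiff (R := R) N) := by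
  apply le_antisymm
  · intro q hq
    have := sub_single_action_mem_range q
    rwa [LinearMap.mem_ker.1 hq, single_zero, sub_zero] at this
  · rintro _ ⟨q, rfl⟩
    induction q using induction_linear with
    | zero => simp
    | add p q hp hq => rw [map_add]; exact add_mem hp hq
    | single i m =>
      rw [LinearMap.mem_ker, koszulDiff_single, map_sub, single_eq_X_pow_smul,
        single_eq_X_pow_smul i, LinearMap.map_smul, LinearMap.map_smul,
        action_single_zero, action_single_zero, pow_succ, mul_smul, sub_self]

end PolynomialModule

open PolynomialModule in
/-- An `R[X]`-module that is projective over `R` has projective dimension at most one over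
`R[X]`, by the exact sequence `0 → N[X] → N[X] → N → 0`. -/
theorem projDimLE_one_of_projective {R : Type u} [CommRing R] (N : Type u) [AddCommGroup N]
    [Module R N] [Module R[X] N] [IsScalarTower R R[X] N] [Module.Projective R N] :
    ProjDimLE R[X] N 1 := by
  have : Module.Projective R[X] (PolynomialModule R N) :=
    Module.Projective.of_equiv (polynomialTensorProductLEquivPolynomialModule R N)
  rw [projDimLE_succ_iff (action (R := R) N) action_surjective 0, projDimLE_zero_iff, ker_action]
  exact Module.Projective.of_equiv (LinearEquiv.ofInjective (koszulDiff N) koszulDiff_injective)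

/-- Adjoining a variable raises the global dimension by at most one. -/
theorem LeftGlobalDimensionLE.polynomial {R : Type u} [CommRing R] {n : ℕ}
    (h : LeftGlobalDimensionLE R n) : LeftGlobalDimensionLE R[X] (n + 1) :=
  h.of_restrictScalars fun N _ _ _ _ _ => projDimLE_one_of_projective N

/-- Hilbert's syzygy theorem. -/
theorem leftGlobalDimensionLE_mvPolynomial (k : Type u) [Field k] (n : ℕ) :
    LeftGlobalDimensionLE (MvPolynomial (Fin n) k) n := by
  induction n with
  | zero =>
    refine LeftGlobalDimensionLE.of_ringEquiv
      (MvPolynomial.isEmptyAlgEquiv k (Fin 0)).symm.toRingEquiv ?_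
    intro M
    have : Module.Projective k M :=
      @Module.Projective.of_free _ _ _ _ _ (Module.Free.of_divisionRing k M)
    exact projDimLE_of_projective (R := k) (M := M) 0
  | succ n ih =>
    exact ih.polynomial.of_ringEquiv (MvPolynomial.finSuccEquiv k n).symm.toRingEquiv

/-- The symmetric algebra of a space of dimension `n` has global dimension at most `n`. -/
theorem leftGlobalDimensionLE_symmetricAlgebra (k : Type) [Field k] (V : Type u) [AddCommGroup V]
    [Module k V] [FiniteDimensional k V] :
    LeftGlobalDimensionLE (SymmetricAlgebra k V) (Module.finrank k V) := by
  -- the scalars are lifted to the universe of `V`, where change of rings is available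
  let e : MvPolynomial (Fin (Module.finrank k V)) (ULift.{u} k) ≃+* SymmetricAlgebra k V :=
    (MvPolynomial.mapEquiv _ ULift.ringEquiv).trans
      (SymmetricAlgebra.equivMvPolynomial (Module.finBasis k V)).symm.toRingEquiv
  exact (leftGlobalDimensionLE_mvPolynomial (ULift.{u} k) _).of_ringEquiv e

end Hilbert

/-! ### Skew group algebras -/

section SkewGroup

lemma IsPrimeRing.of_ringEquiv {R S : Type*} [Ring R] [Ring S] (e : R ≃+* S) (h : IsPrimeRing R) :
    IsPrimeRing S := by
  have := h.nontrivial
  refine ⟨e.symm.toEquiv.nontrivial, fun a b hab => ?_⟩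
  refine (h.eq_zero_or_eq_zero (e.symm a) (e.symm b) fun r => ?_).imp
    (fun ha => by simpa using ha) (fun hb => by simpa using hb)
  simpa using congrArg e.symm (hab (e r))

namespace SkewMonoidAlgebra

variable {S : Type*} {G : Type*} [CommRing S] [Group G] [MulSemiringAction G S]

lemma single_eq_smul_of (g : G) (a : S) : single g a = a • of S G g := by
  rw [smul_of]

lemma of_mul_single_one (g : G) (a : S) : of S G g * single 1 a = (g • a) • of S G g := by
  rw [smul_of]
  simp [single_mul_single]

/-- A skew group algebra of a finite group over a commutative noetherian ring is left
noetherian. -/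
theorem isNoetherianRing [Finite G] [IsNoetherianRing S] :
    IsNoetherianRing (SkewMonoidAlgebra S G) := by
  have : Module.Finite S (SkewMonoidAlgebra S G) := Module.Finite.of_basis basisSingleOne
  exact isNoetherian_of_tower S inferInstance

/-- A skew group algebra over a domain with faithful action is prime: a nonzero two-sided ideal
contains a nonzero element of the coefficient domain. -/
theorem isPrimeRing [IsDomain S] [FaithfulSMul G S] : IsPrimeRing (SkewMonoidAlgebra S G) := by
  classical
  refine ⟨inferInstance, fun a b h => ?_⟩
  by_contra! hab
  obtain ⟨ha, hb⟩ := hab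
  let I : Set (SkewMonoidAlgebra S G) := {x | x ≠ 0 ∧ ∀ r, a * r * x = 0}
  -- `y` is a nonzero element of `I` of minimal support with `1` in its support
  obtain ⟨x, ⟨hx0, hx⟩, hmin⟩ :=
    WellFounded.has_min (measure fun x : SkewMonoidAlgebra S G => x.support.card).wf I ⟨b, hb, h⟩
  obtain ⟨g, hg⟩ : ∃ g, x.coeff g ≠ 0 := by
    by_contra! h0
    exact hx0 (ext h0)
  let y := x * of S G g⁻¹
  have hyc (k : G) : y.coeff k = x.coeff (k * g) := by
    simp [y, coeff_mul_single]
  have hy1 : y.coeff 1 ≠ 0 := by rwa [hyc, one_mul]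
  have hy (r) : a * r * y = 0 := by simp only [y, ← mul_assoc, hx, zero_mul]
  have hcard : y.support.card ≤ x.support.card := by
    refine Finset.card_le_card_of_injOn (· * g) (fun k hk => ?_) (mul_left_injective g).injOn
    rw [Finset.mem_coe, mem_support_iff] at hk ⊢
    rwa [hyc] at hk
  -- commutators of `y` with `S` lie in the ideal and have smaller support, hence vanish
  have hcomm (t : S) : single 1 t * y - y * single 1 t = 0 := by
    by_contra hne
    refine hmin _ ⟨hne, fun r => ?_⟩ (lt_of_lt_of_le (Finset.card_lt_card ?_) hcard)
    · have h1 := hy (r * single 1 t)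
      rw [mul_sub, ← mul_assoc (a * r) y, hy, zero_mul, sub_zero, ← mul_assoc, mul_assoc a, h1]
    · refine Finset.ssubset_iff_subset_ne.2 ⟨fun k hk => ?_, fun heq => ?_⟩
      · rw [mem_support_iff] at hk ⊢
        intro h0
        apply hk
        simp [h0]
      · have h1 : (1 : G) ∈ y.support := mem_support_iff.2 hy1
        rw [← heq, mem_support_iff] at h1
        apply h1
        simp [mul_comm]
  -- so `t = k • t` for all `k` in the support of `y`, and `y` is concentrated at `1`
  have hsupp (k : G) (hk : k ≠ 1) : y.coeff k = 0 := by
    by_contra h0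
    apply hk
    refine FaithfulSMul.eq_of_smul_eq_smul (α := S) fun t => ?_
    have h1 := congrArg (fun z => coeff z k) (hcomm t)
    simp only [coeff_sub, Finsupp.sub_apply, coeff_single_one_mul, coeff_mul_single_one,
      coeff_zero, Finsupp.zero_apply] at h1
    rw [mul_comm, ← mul_sub, mul_eq_zero] at h1
    rw [one_smul]
    exact (sub_eq_zero.1 (h1.resolve_left h0)).symm
  have hy' : y = single 1 (y.coeff 1) := by
    ext k
    rw [coeff_single_apply]
    split_ifs with hk
    · rw [hk]
    · exact hsupp k (Ne.symm hk)
  apply ha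
  ext k
  have h1 := congrArg (fun z => coeff z k) (hy 1)
  rw [mul_one, hy'] at h1
  simp only [coeff_mul_single_one, coeff_zero, Finsupp.zero_apply, mul_eq_zero] at h1
  refine h1.resolve_right fun h2 => hy1 ?_
  exact (smul_eq_zero_iff_eq k).1 h2

section Maschke

variable {M P : Type*} [AddCommGroup M] [AddCommGroup P] [Module S M] [Module S P]
  [Module (SkewMonoidAlgebra S G) M] [Module (SkewMonoidAlgebra S G) P]
  [IsScalarTower S (SkewMonoidAlgebra S G) M] [IsScalarTower S (SkewMonoidAlgebra S G) P]

lemma of_smul_smul (g : G) (a : S) (m : M) :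
    of S G g • a • m = (g • a) • of S G g • m := by
  rw [← smul_assoc (g • a), ← of_mul_single_one, mul_smul, single_eq_smul_of, smul_assoc, map_one,
    one_smul]

/-- The trace `m ↦ ∑ g, g s (g⁻¹ m)` of an `S`-linear map between modules over a skew group
algebra. -/
noncomputable def traceMap [Fintype G] (s : M →ₗ[S] P) : M →ₗ[SkewMonoidAlgebra S G] P where
  toFun m := ∑ g : G, of S G g • s (of S G g⁻¹ • m)
  map_add' a b := by simp only [smul_add, map_add, Finset.sum_add_distrib]
  map_smul' x m := by
    simp only [RingHom.id_apply]
    induction x using induction_on with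
    | zero => simp
    | add x y hx hy => simp only [add_smul, ← hx, ← hy, smul_add, map_add, Finset.sum_add_distrib]
    | single h a =>
      rw [single_eq_smul_of, smul_assoc, smul_assoc, Finset.smul_sum, Finset.smul_sum,
        ← Equiv.sum_comp (Equiv.mulLeft h)]
      refine Finset.sum_congr rfl fun g _ => ?_
      rw [of_smul_smul, map_smul, of_smul_smul, smul_inv_smul]
      simp only [Equiv.coe_mulLeft, ← mul_smul, ← map_mul]
      simp

lemma traceMap_apply [Fintype G] (s : M →ₗ[S] P) (m : M) :
    traceMap (G := G) s m = ∑ g : G, of S G g • s (of S G g⁻¹ • m) := rfl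

/-- Maschke's theorem for skew group algebras: when `|G|` is invertible, a module over the skew
group algebra is projective as soon as it is projective over the coefficients. -/
theorem projective_of_projective_coeff [Finite G] (hG : IsUnit (Nat.card G : S))
    [Module.Projective S M] : Module.Projective (SkewMonoidAlgebra S G) M := by
  have := Fintype.ofFinite G
  let π : (M →₀ SkewMonoidAlgebra S G) →ₗ[SkewMonoidAlgebra S G] M :=
    Finsupp.linearCombination _ id
  have hπ : Function.Surjective π := Finsupp.linearCombination_id_surjective _ M
  have : IsScalarTower S (SkewMonoidAlgebra S G) (M →₀ SkewMonoidAlgebra S G) :=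
    ⟨fun r s x => by ext1; simp⟩
  obtain ⟨s, hs⟩ := (π.restrictScalars S).exists_rightInverse_of_surjective
    (LinearMap.range_eq_top.2 hπ)
  have hs' (m : M) : π (s m) = m := LinearMap.congr_fun hs m
  obtain ⟨u, hu⟩ : IsUnit (Nat.card G : SkewMonoidAlgebra S G) := by
    have := hG.map (singleOneRingHom (k := S) (G := G))
    rwa [map_natCast] at this
  have hcomm (x : SkewMonoidAlgebra S G) : (↑u⁻¹ : SkewMonoidAlgebra S G) * x = x * ↑u⁻¹ := by
    have : Commute (u : SkewMonoidAlgebra S G) x := hu ▸ Nat.cast_commute _ _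
    exact this.units_inv_left
  let t : M →ₗ[SkewMonoidAlgebra S G] (M →₀ SkewMonoidAlgebra S G) :=
    { toFun := fun m => (↑u⁻¹ : SkewMonoidAlgebra S G) • traceMap (G := G) s m
      map_add' := fun a b => by rw [map_add, smul_add]
      map_smul' := fun x m => by
        rw [map_smul, ← mul_smul, hcomm, mul_smul, RingHom.id_apply] }
  refine Module.Projective.of_split t π ?_
  ext m
  change π ((↑u⁻¹ : SkewMonoidAlgebra S G) • traceMap (G := G) s m) = m
  rw [map_smul, traceMap_apply, _root_.map_sum]
  have (g : G) : π (of S G g • s (of S G g⁻¹ • m)) = m := by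
    rw [map_smul, hs', ← mul_smul, ← map_mul, mul_inv_cancel, map_one, one_smul]
  simp only [this, Finset.sum_const, Finset.card_univ]
  rw [← Nat.card_eq_fintype_card, ← Nat.cast_smul_eq_nsmul (SkewMonoidAlgebra S G), ← hu, smul_smul,
    Units.inv_mul, one_smul]

end Maschke

/-- The anti-automorphism `a g ↦ g⁻¹ a` of a skew group algebra with commutative coefficients. -/
noncomputable def toOpposite : SkewMonoidAlgebra S G →+* (SkewMonoidAlgebra S G)ᵐᵒᵖ :=
  liftNCRingHom
    ((singleOneRingHom (k := S) (G := G)).toOpposite fun a b => by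
      rw [commute_iff_eq, ← map_mul, ← map_mul, mul_comm])
    { toFun := fun g => MulOpposite.op (of S G g⁻¹)
      map_one' := by simp
      map_mul' := fun g h => by rw [mul_inv_rev, map_mul]; rfl }
    (fun {a g} => by
      apply MulOpposite.unop_injective
      simp [singleOneRingHom, single_mul_single])

lemma toOpposite_single (g : G) (a : S) :
    toOpposite (single g a) = MulOpposite.op (single g⁻¹ (g⁻¹ • a)) := by
  apply MulOpposite.unop_injective
  simp [toOpposite, liftNCRingHom, singleOneRingHom, single_mul_single]

lemma unop_toOpposite_unop_toOpposite (x : SkewMonoidAlgebra S G) :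
    (toOpposite (toOpposite x).unop).unop = x := by
  induction x using induction_on with
  | zero => simp
  | add x y hx hy => simp only [map_add, MulOpposite.unop_add, hx, hy]
  | single g a => simp [toOpposite_single]

/-- A skew group algebra with commutative coefficients is isomorphic to its opposite. -/
noncomputable def opRingEquiv : SkewMonoidAlgebra S G ≃+* (SkewMonoidAlgebra S G)ᵐᵒᵖ :=
  RingEquiv.ofBijective toOpposite
    ⟨fun x y h => by
      rw [← unop_toOpposite_unop_toOpposite x, h, unop_toOpposite_unop_toOpposite],
    fun x => ⟨(toOpposite x.unop).unop, by
      apply MulOpposite.unop_injective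
      rw [unop_toOpposite_unop_toOpposite]⟩⟩

end SkewMonoidAlgebra

/-- Passing from `S` to a skew group algebra does not raise the global dimension when the order of
the group is invertible. -/
theorem LeftGlobalDimensionLE.skewMonoidAlgebra {S : Type u} {G : Type u} [CommRing S] [Group G]
    [MulSemiringAction G S] [Finite G] (hG : IsUnit (Nat.card G : S)) {n : ℕ}
    (h : LeftGlobalDimensionLE S n) : LeftGlobalDimensionLE (SkewMonoidAlgebra S G) n :=
  h.of_restrictScalars (c := 0) fun _ _ _ _ _ _ =>
    projDimLE_zero_iff.2 (SkewMonoidAlgebra.projective_of_projective_coeff hG)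

end SkewGroup

/-! ### Filtered rings and modules and their symbols -/

section Symbols

/-- A filtered additive group `M` together with a model `L` of its associated graded group.
The filtration is indexed with a shift, `fil (n + 1)` being the step of degree `n` and `fil 0 = 0`;
`sym n` is the map from the step of degree `n` to `L` with kernel the previous step (its values
outside `fil (n + 1)` are irrelevant), and `comp n` is the projection of `L` onto its homogeneous
component of degree `n`. -/
structure FiltSymbol (M L : Type*) [AddCommGroup M] [AddCommGroup L] where
  fil : ℕ → AddSubgroup M
  mono : Monotone fil
  fil_zero : fil 0 = ⊥
  exhaustive : ∀ m, ∃ n, m ∈ fil n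
  sym : ℕ → M → L
  sym_add : ∀ {n a b}, a ∈ fil (n + 1) → b ∈ fil (n + 1) → sym n (a + b) = sym n a + sym n b
  sym_eq_zero_iff : ∀ {n a}, a ∈ fil (n + 1) → (sym n a = 0 ↔ a ∈ fil n)
  closure_eq_top : AddSubgroup.closure {x | ∃ n, ∃ a ∈ fil (n + 1), sym n a = x} = ⊤
  comp : ℕ → L →+ L
  comp_sym : ∀ {n a} (m : ℕ), a ∈ fil (n + 1) → comp m (sym n a) = if m = n then sym n a else 0

namespace FiltSymbol

variable {M L : Type*} [AddCommGroup M] [AddCommGroup L] (τ : FiltSymbol M L)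

@[simp] lemma sym_zero (n : ℕ) : τ.sym n 0 = 0 :=
  (τ.sym_eq_zero_iff (zero_mem _)).2 (zero_mem _)

lemma sym_neg {n : ℕ} {a : M} (ha : a ∈ τ.fil (n + 1)) : τ.sym n (-a) = -τ.sym n a := by
  rw [eq_neg_iff_add_eq_zero, ← τ.sym_add (neg_mem ha) ha, neg_add_cancel, sym_zero]

lemma sym_sub {n : ℕ} {a b : M} (ha : a ∈ τ.fil (n + 1)) (hb : b ∈ τ.fil (n + 1)) :
    τ.sym n (a - b) = τ.sym n a - τ.sym n b := by
  rw [sub_eq_add_neg, τ.sym_add ha (neg_mem hb), τ.sym_neg hb, sub_eq_add_neg]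

lemma sym_sum {n : ℕ} {ι : Type*} (s : Finset ι) (f : ι → M)
    (hf : ∀ i ∈ s, f i ∈ τ.fil (n + 1)) : τ.sym n (∑ i ∈ s, f i) = ∑ i ∈ s, τ.sym n (f i) := by
  classical
  induction s using Finset.induction_on with
  | empty => simp
  | insert i s hi ih =>
    rw [Finset.sum_insert hi, Finset.sum_insert hi,
      τ.sym_add (hf _ (Finset.mem_insert_self i s))
        (sum_mem fun j hj => hf j (Finset.mem_insert_of_mem hj)),
      ih fun j hj => hf j (Finset.mem_insert_of_mem hj)]

lemma sym_eq_iff {n : ℕ} {a b : M} (ha : a ∈ τ.fil (n + 1)) (hb : b ∈ τ.fil (n + 1)) :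
    τ.sym n a = τ.sym n b ↔ a - b ∈ τ.fil n := by
  rw [← τ.sym_eq_zero_iff (sub_mem ha hb), τ.sym_sub ha hb, sub_eq_zero]

lemma comp_sym_self {n : ℕ} {a : M} (ha : a ∈ τ.fil (n + 1)) :
    τ.comp n (τ.sym n a) = τ.sym n a := by
  rw [τ.comp_sym n ha, if_pos rfl]

lemma eq_zero_of_mem_fil_zero {a : M} (ha : a ∈ τ.fil 0) : a = 0 := by
  rwa [τ.fil_zero, AddSubgroup.mem_bot] at ha

/-- Induction on `L`: it is additively generated by the symbols. -/
lemma induction {p : L → Prop} (x : L) (zero : p 0) (add : ∀ x y, p x → p y → p (x + y))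
    (neg : ∀ x, p x → p (-x)) (sym : ∀ n, ∀ a ∈ τ.fil (n + 1), p (τ.sym n a)) : p x := by
  have hx : x ∈ AddSubgroup.closure {x | ∃ n, ∃ a ∈ τ.fil (n + 1), τ.sym n a = x} := by
    rw [τ.closure_eq_top]; trivial
  induction hx using AddSubgroup.closure_induction with
  | mem x hx => obtain ⟨n, a, ha, rfl⟩ := hx; exact sym n a ha
  | zero => exact zero
  | add x y _ _ hx hy => exact add x y hx hy
  | neg x _ hx => exact neg x hx

lemma exists_sym_eq_comp (n : ℕ) (x : L) : ∃ a ∈ τ.fil (n + 1), τ.sym n a = τ.comp n x := by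
  induction x using τ.induction with
  | zero => exact ⟨0, zero_mem _, by simp⟩
  | add x y hx hy =>
    obtain ⟨a, ha, hax⟩ := hx
    obtain ⟨b, hb, hby⟩ := hy
    exact ⟨a + b, add_mem ha hb, by rw [τ.sym_add ha hb, hax, hby, map_add]⟩
  | neg x hx =>
    obtain ⟨a, ha, hax⟩ := hx
    exact ⟨-a, neg_mem ha, by rw [τ.sym_neg ha, hax, map_neg]⟩
  | sym m a ha =>
    rw [τ.comp_sym n ha]
    split_ifs with h
    · subst h; exact ⟨a, ha, rfl⟩
    · exact ⟨0, zero_mem _, by simp⟩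

lemma exists_sum_comp_eq (x : L) : ∃ N, ∑ n ∈ Finset.range N, τ.comp n x = x := by
  suffices h : ∃ N, ∀ K ≥ N, ∑ n ∈ Finset.range K, τ.comp n x = x from
    h.imp fun N hN => hN N le_rfl
  induction x using τ.induction with
  | zero => exact ⟨0, by simp⟩
  | add x y hx hy =>
    obtain ⟨N, hN⟩ := hx
    obtain ⟨N', hN'⟩ := hy
    refine ⟨max N N', fun K hK => ?_⟩
    simp only [map_add, Finset.sum_add_distrib, hN K (le_trans (le_max_left _ _) hK),
      hN' K (le_trans (le_max_right _ _) hK)]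
  | neg x hx =>
    obtain ⟨N, hN⟩ := hx
    exact ⟨N, fun K hK => by simp only [map_neg, Finset.sum_neg_distrib, hN K hK]⟩
  | sym m a ha =>
    refine ⟨m + 1, fun K hK => ?_⟩
    simp only [τ.comp_sym _ ha, Finset.sum_ite_eq', Finset.mem_range]
    rw [if_pos (by omega)]

/-- A nonzero element has a nonzero leading symbol. -/
lemma exists_sym_ne_zero {a : M} (ha : a ≠ 0) : ∃ n, a ∈ τ.fil (n + 1) ∧ τ.sym n a ≠ 0 := by
  classical
  have h := τ.exhaustive a
  obtain ⟨n, hn⟩ : ∃ n, Nat.find h = n + 1 := by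
    refine Nat.exists_eq_succ_of_ne_zero fun h0 => ha ?_
    exact τ.eq_zero_of_mem_fil_zero (h0 ▸ Nat.find_spec h)
  have hmem : a ∈ τ.fil (n + 1) := hn ▸ Nat.find_spec h
  exact ⟨n, hmem, fun h0 => Nat.find_min h (m := n) (by omega) ((τ.sym_eq_zero_iff hmem).1 h0)⟩

end FiltSymbol

/-- A filtered ring `A` together with a model `R` of its associated graded ring. -/
structure RingSymbol (A R : Type*) [Ring A] [Ring R] extends FiltSymbol A R where
  one_mem : 1 ∈ fil 1
  mul_mem : ∀ {i j a b}, a ∈ fil (i + 1) → b ∈ fil (j + 1) → a * b ∈ fil (i + j + 1)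
  sym_one : sym 0 1 = 1
  sym_mul : ∀ {i j a b}, a ∈ fil (i + 1) → b ∈ fil (j + 1) →
    sym (i + j) (a * b) = sym i a * sym j b

/-- A filtered module `M` over a filtered ring together with a model `L` of its associated graded
module. -/
structure ModuleSymbol {A R : Type*} [Ring A] [Ring R] (s : RingSymbol A R) (M L : Type*)
    [AddCommGroup M] [AddCommGroup L] [Module A M] [Module R L] extends FiltSymbol M L where
  smul_mem : ∀ {i j a m}, a ∈ s.fil (i + 1) → m ∈ fil (j + 1) → a • m ∈ fil (i + j + 1)
  sym_smul : ∀ {i j a m}, a ∈ s.fil (i + 1) → m ∈ fil (j + 1) →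
    sym (i + j) (a • m) = s.sym i a • sym j m

/-- A filtered ring as a filtered module over itself. -/
def RingSymbol.self {A R : Type*} [Ring A] [Ring R] (s : RingSymbol A R) : ModuleSymbol s A R where
  __ := s.toFiltSymbol
  smul_mem := s.mul_mem
  sym_smul := s.sym_mul

/-- The opposite of a filtered ring. -/
def RingSymbol.op {A R : Type*} [Ring A] [Ring R] (s : RingSymbol A R) :
    RingSymbol Aᵐᵒᵖ Rᵐᵒᵖ where
  fil n := (s.fil n).comap (MulOpposite.opAddEquiv (α := A)).symm.toAddMonoidHom
  mono _ _ h _ hx := s.mono h hx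
  fil_zero := by
    rw [s.fil_zero]
    ext x
    simp
  exhaustive m := s.exhaustive m.unop
  sym n a := MulOpposite.op (s.sym n a.unop)
  sym_add ha hb := congrArg MulOpposite.op (s.sym_add ha hb)
  sym_eq_zero_iff ha := (MulOpposite.op_eq_zero_iff _).trans (s.sym_eq_zero_iff ha)
  closure_eq_top := by
    rw [eq_top_iff]
    rintro x -
    obtain ⟨x, rfl⟩ := MulOpposite.op_surjective x
    induction x using s.induction with
    | zero => exact zero_mem _
    | add x y hx hy => exact add_mem hx hy
    | neg x hx => exact neg_mem hx
    | sym n a ha => exact AddSubgroup.subset_closure ⟨n, MulOpposite.op a, ha, rfl⟩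
  comp n := (MulOpposite.opAddEquiv.toAddMonoidHom.comp (s.comp n)).comp
    MulOpposite.opAddEquiv.symm.toAddMonoidHom
  comp_sym {n a} m ha := by
    change MulOpposite.op (s.comp m (s.sym n a.unop)) = _
    rw [s.comp_sym (a := a.unop) m ha]
    split_ifs <;> rfl
  one_mem := s.one_mem
  mul_mem {i j _ _} ha hb := by
    rw [add_comm i j]
    exact s.mul_mem hb ha
  sym_one := congrArg MulOpposite.op s.sym_one
  sym_mul {i j _ _} ha hb := by
    rw [add_comm i j]
    exact congrArg MulOpposite.op (s.sym_mul hb ha)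

namespace ModuleSymbol

variable {A R : Type*} [Ring A] [Ring R] {s : RingSymbol A R} {M L : Type*}
    [AddCommGroup M] [AddCommGroup L] [Module A M] [Module R L] (τ : ModuleSymbol s M L)

lemma comp_sym_smul {i : ℕ} {a : A} (ha : a ∈ s.fil (i + 1)) (n : ℕ) (x : L) :
    τ.comp n (s.sym i a • x) = if i ≤ n then s.sym i a • τ.comp (n - i) x else 0 := by
  induction x using τ.induction with
  | zero => simp
  | add x y hx hy => rw [smul_add, map_add, hx, hy]; split_ifs <;> simp
  | neg x hx => rw [smul_neg, map_neg, hx]; split_ifs <;> simp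
  | sym m b hb =>
    rw [← τ.sym_smul ha hb, τ.comp_sym n (τ.smul_mem ha hb), τ.comp_sym _ hb]
    by_cases h : n = i + m
    · subst h; simp [τ.sym_smul ha hb]
    · rw [if_neg h]
      split_ifs with h1 h2
      · omega
      · simp
      · rfl

/-- The associated graded submodule of a submodule. -/
def gr (N : Submodule A M) : Submodule R L where
  carrier := {x | ∀ n, ∃ a ∈ N, a ∈ τ.fil (n + 1) ∧ τ.sym n a = τ.comp n x}
  zero_mem' n := ⟨0, zero_mem _, zero_mem _, by simp⟩
  add_mem' {x y} hx hy n := by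
    obtain ⟨a, haN, ha, hax⟩ := hx n
    obtain ⟨b, hbN, hb, hby⟩ := hy n
    exact ⟨a + b, add_mem haN hbN, add_mem ha hb, by rw [τ.sym_add ha hb, hax, hby, map_add]⟩
  smul_mem' r x hx := by
    induction r using s.induction with
    | zero => exact fun n => ⟨0, zero_mem _, zero_mem _, by simp⟩
    | add r r' h h' =>
      intro n
      obtain ⟨a, haN, ha, hax⟩ := h n
      obtain ⟨b, hbN, hb, hby⟩ := h' n
      exact ⟨a + b, add_mem haN hbN, add_mem ha hb,
        by rw [τ.sym_add ha hb, hax, hby, add_smul, map_add]⟩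
    | neg r h =>
      intro n
      obtain ⟨a, haN, ha, hax⟩ := h n
      exact ⟨-a, neg_mem haN, neg_mem ha, by rw [τ.sym_neg ha, hax, neg_smul, map_neg]⟩
    | sym i b hb =>
      intro n
      rw [τ.comp_sym_smul hb]
      split_ifs with hin
      · obtain ⟨a, haN, ha, hax⟩ := hx (n - i)
        have hn : n = i + (n - i) := by omega
        refine ⟨b • a, N.smul_mem b haN, ?_, ?_⟩
        · rw [hn]; exact τ.smul_mem hb ha
        · rw [← hax, ← τ.sym_smul hb ha, ← hn]
      · exact ⟨0, zero_mem _, zero_mem _, by simp⟩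

lemma gr_mono {N N' : Submodule A M} (h : N ≤ N') : τ.gr N ≤ τ.gr N' := fun _ hx n => by
  obtain ⟨a, haN, ha⟩ := hx n
  exact ⟨a, h haN, ha⟩

/-- Nested submodules with the same associated graded submodule are equal. -/
lemma le_of_gr_le {N N' : Submodule A M} (h : N ≤ N') (hgr : τ.gr N' ≤ τ.gr N) : N' ≤ N := by
  suffices H : ∀ n, ∀ a ∈ N', a ∈ τ.fil n → a ∈ N by
    intro a ha
    obtain ⟨n, hn⟩ := τ.exhaustive a
    exact H n a ha hn
  intro n
  induction n with
  | zero =>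
    intro a _ ha
    rw [τ.eq_zero_of_mem_fil_zero ha]
    exact zero_mem _
  | succ n ih =>
    intro a haN ha
    have hgra : τ.sym n a ∈ τ.gr N' := fun m => by
      rw [τ.comp_sym m ha]
      split_ifs with hm
      · subst hm; exact ⟨a, haN, ha, rfl⟩
      · exact ⟨0, zero_mem _, zero_mem _, by simp⟩
    obtain ⟨b, hbN, hb, hba⟩ := hgr hgra n
    rw [τ.comp_sym_self ha, eq_comm, τ.sym_eq_iff ha hb] at hba
    have := add_mem (ih (a - b) (sub_mem haN (h hbN)) hba) hbN
    rwa [sub_add_cancel] at this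

lemma gr_strictMono : StrictMono τ.gr := fun _ _ h =>
  lt_of_le_not_ge (τ.gr_mono h.le) fun h' => h.not_ge (τ.le_of_gr_le h.le h')

end ModuleSymbol

namespace RingSymbol

variable {A R : Type*} [Ring A] [Ring R]

/-- A filtered ring is left noetherian if its associated graded ring is. -/
theorem isNoetherianRing (s : RingSymbol A R) (h : IsNoetherianRing R) : IsNoetherianRing A := by
  rw [isNoetherianRing_iff, isNoetherian_iff'] at h ⊢
  exact s.self.gr_strictMono.wellFoundedGT

/-- A filtered ring is prime if its associated graded ring is. -/
theorem isPrimeRing (s : RingSymbol A R) (h : IsPrimeRing R) : IsPrimeRing A := by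
  have := h.nontrivial
  refine ⟨⟨1, 0, fun h0 => one_ne_zero (α := R) ?_⟩, fun a b hab => ?_⟩
  · rw [← s.sym_one, h0, s.sym_zero]
  · by_contra! hne
    obtain ⟨i, hai, ha⟩ := s.exists_sym_ne_zero hne.1
    obtain ⟨j, hbj, hb⟩ := s.exists_sym_ne_zero hne.2
    refine (h.eq_zero_or_eq_zero (s.sym i a) (s.sym j b) fun r => ?_).elim ha hb
    induction r using s.induction with
    | zero => simp
    | add x y hx hy => rw [mul_add, add_mul, hx, hy, add_zero]
    | neg x hx => rw [mul_neg, neg_mul, hx, neg_zero]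
    | sym n r hr =>
      rw [← s.sym_mul hai hr, ← s.sym_mul (s.mul_mem hai hr) hbj, hab, s.sym_zero]

end RingSymbol

end Symbols

/-! ### Projective dimension of filtered modules -/

section FilteredModules

namespace RingSymbol

section Augmentation

variable {A R : Type*} [Ring A] [Ring R] (s : RingSymbol A R)

lemma comp_zero_mul (x y : R) : s.comp 0 (x * y) = s.comp 0 x * s.comp 0 y := by
  induction x using s.induction with
  | zero => simp
  | add x x' hx hx' => rw [add_mul, map_add, hx, hx', map_add, add_mul]
  | neg x hx => rw [neg_mul, map_neg, hx, map_neg, neg_mul]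
  | sym i a ha =>
    have h := s.self.comp_sym_smul ha 0 y
    change s.comp 0 (s.sym i a * y) = if i ≤ 0 then s.sym i a * s.comp (0 - i) y else 0 at h
    rw [h, s.comp_sym 0 ha]
    rcases Nat.eq_zero_or_pos i with rfl | hi
    · simp
    · rw [if_neg (by omega), if_neg (by omega), zero_mul]

/-- The lift to `A` of the component of degree zero. -/
noncomputable def liftZero (x : R) : A := (s.exists_sym_eq_comp 0 x).choose

lemma liftZero_mem (x : R) : liftZero s x ∈ s.fil 1 := (s.exists_sym_eq_comp 0 x).choose_spec.1

lemma sym_liftZero (x : R) : s.sym 0 (liftZero s x) = s.comp 0 x :=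
  (s.exists_sym_eq_comp 0 x).choose_spec.2

lemma liftZero_eq {x : R} {a : A} (ha : a ∈ s.fil 1) (h : s.sym 0 a = s.comp 0 x) :
    liftZero s x = a := by
  rw [← sym_liftZero, eq_comm, s.sym_eq_iff (liftZero_mem s x) ha] at h
  exact sub_eq_zero.1 (s.eq_zero_of_mem_fil_zero h)

/-- The augmentation `gr A → gr₀ A = F₀ A ⊆ A`. -/
noncomputable def augmentation : R →+* A where
  toFun := liftZero s
  map_one' := liftZero_eq s s.one_mem (by rw [← s.sym_one, s.comp_sym_self s.one_mem])
  map_zero' := liftZero_eq s (zero_mem _) (by simp)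
  map_add' x y := liftZero_eq s (add_mem (liftZero_mem s x) (liftZero_mem s y)) (by
    rw [s.sym_add (liftZero_mem s x) (liftZero_mem s y), sym_liftZero, sym_liftZero, map_add])
  map_mul' x y := liftZero_eq s (s.mul_mem (liftZero_mem s x) (liftZero_mem s y)) (by
    have := s.sym_mul (liftZero_mem s x) (liftZero_mem s y)
    rw [comp_zero_mul, ← sym_liftZero, ← sym_liftZero]
    exact this)

lemma augmentation_sym_zero {a : A} (ha : a ∈ s.fil 1) : augmentation s (s.sym 0 a) = a :=
  liftZero_eq s ha (s.comp_sym_self ha).symm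

lemma augmentation_sym {i : ℕ} {a : A} (ha : a ∈ s.fil (i + 1)) (hi : i ≠ 0) :
    augmentation s (s.sym i a) = 0 :=
  liftZero_eq s (zero_mem _) (by rw [s.comp_sym 0 ha, if_neg hi.symm, s.sym_zero])

/-- Degrees shifted by `n`; truncated subtraction is harmless because `fil 0 = 0`. -/
lemma mul_mem_fil_sub {i j n : ℕ} {a x : A} (ha : a ∈ s.fil (i + 1)) (hx : x ∈ s.fil (j + 1 - n)) :
    a * x ∈ s.fil (i + j + 1 - n) := by
  rcases Nat.lt_or_ge j n with h | h
  · rw [show j + 1 - n = 0 by omega] at hx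
    rw [s.eq_zero_of_mem_fil_zero hx, mul_zero]
    exact zero_mem _
  · rw [show j + 1 - n = (j - n) + 1 by omega] at hx
    rw [show i + j + 1 - n = i + (j - n) + 1 by omega]
    exact s.mul_mem ha hx

end Augmentation

end RingSymbol

namespace ModuleSymbol

section Trivial

variable {A R : Type*} [Ring A] [Ring R] (s : RingSymbol A R)
  (M : Type*) [AddCommGroup M] [Module A M]

/-- Any module `M` with the filtration `F i M = M` for all `i ≥ 0`. Its associated graded module is
`M` itself in degree zero, on which `gr A` acts through the augmentation. -/
noncomputable def trivial :
    @ModuleSymbol A R _ _ s M M _ _ _ (Module.compHom M s.augmentation) :=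
  letI : Module R M := Module.compHom M s.augmentation
  { fil := fun n => if n = 0 then ⊥ else ⊤
    mono := fun m n h => by
      dsimp only
      split_ifs <;> first | omega | simp
    fil_zero := by simp
    exhaustive := fun m => ⟨1, by simp⟩
    sym := fun n m => if n = 0 then m else 0
    sym_add := fun {n a b} _ _ => by split_ifs <;> simp
    sym_eq_zero_iff := fun {n a} _ => by split_ifs <;> simp
    closure_eq_top := by
      rw [eq_top_iff]
      exact fun m _ => AddSubgroup.subset_closure ⟨0, m, by simp, by simp⟩
    comp := fun n => if n = 0 then AddMonoidHom.id M else 0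
    comp_sym := fun {n a} m _ => by
      by_cases hm : m = 0 <;> by_cases hn : n = 0 <;> simp [hm, hn, Ne.symm]
    smul_mem := fun {i j a m} _ _ => by simp
    sym_smul := fun {i j a m} ha _ => by
      change (if i + j = 0 then a • m else 0) =
        s.augmentation (s.sym i a) • (if j = 0 then m else 0)
      by_cases hi : i = 0
      · subst hi
        rw [s.augmentation_sym_zero ha]
        by_cases hj : j = 0 <;> simp [hj]
      · rw [s.augmentation_sym ha hi]
        simp [hi] }

end Trivial

section Free

variable {A R : Type*} [Ring A] [Ring R] (s : RingSymbol A R) {I : Type*} (d : I → ℕ)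

/-- The free filtered module on generators `e i` of degree `d i`. The coefficients of `e i` in
`fil n` range over `s.fil (n - d i)`, which is zero, as it should be, when `n ≤ d i`. -/
noncomputable def free : ModuleSymbol s (I →₀ A) (I →₀ R) where
  fil n :=
    { carrier := {x | ∀ i, x i ∈ s.fil (n - d i)}
      zero_mem' := fun i => zero_mem _
      add_mem' := fun hx hy i => add_mem (hx i) (hy i)
      neg_mem' := fun hx i => neg_mem (hx i) }
  mono m n h x hx i := s.mono (Nat.sub_le_sub_right h _) (hx i)
  fil_zero := by
    rw [eq_bot_iff]
    intro x hx
    rw [AddSubgroup.mem_bot]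
    ext i
    have := hx i
    rw [Nat.zero_sub] at this
    exact s.eq_zero_of_mem_fil_zero this
  exhaustive x := by
    choose N hN using fun i => s.exhaustive (x i)
    refine ⟨∑ i ∈ x.support, (N i + d i), fun i => ?_⟩
    by_cases hi : i ∈ x.support
    · refine s.mono ?_ (hN i)
      have := Finset.single_le_sum (f := fun i => N i + d i) (fun _ _ => Nat.zero_le _) hi
      omega
    · rw [Finsupp.notMem_support_iff.1 hi]
      exact zero_mem _
  sym n x := Finsupp.onFinset x.support (fun i => if d i ≤ n then s.sym (n - d i) (x i) else 0)
    (fun i hi => by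
      rw [Finsupp.mem_support_iff]
      rintro h
      simp [h] at hi)
  sym_add {n x y} hx hy := by
    ext i
    simp only [Finsupp.onFinset_apply, Finsupp.add_apply]
    split_ifs with h
    · have hxi := hx i
      have hyi := hy i
      rw [show n + 1 - d i = (n - d i) + 1 by omega] at hxi hyi
      exact s.sym_add hxi hyi
    · simp
  sym_eq_zero_iff {n x} hx := by
    rw [Finsupp.ext_iff]
    refine forall_congr' fun i => ?_
    have hxi := hx i
    simp only [Finsupp.onFinset_apply, Finsupp.zero_apply]
    split_ifs with h
    · rw [show n + 1 - d i = (n - d i) + 1 by omega] at hxi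
      exact s.sym_eq_zero_iff hxi
    · rw [show n + 1 - d i = 0 by omega] at hxi
      rw [s.eq_zero_of_mem_fil_zero hxi]
      exact iff_of_true rfl (zero_mem _)
  closure_eq_top := by
    classical
    rw [eq_top_iff]
    rintro x -
    induction x using Finsupp.induction_linear with
    | zero => exact zero_mem _
    | add x y hx hy => exact add_mem hx hy
    | single i r =>
      induction r using s.induction with
      | zero => rw [Finsupp.single_zero]; exact zero_mem _
      | add x y hx hy => rw [Finsupp.single_add]; exact add_mem hx hy
      | neg x hx => rw [Finsupp.single_neg]; exact neg_mem hx
      | sym n a ha =>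
        refine AddSubgroup.subset_closure ⟨n + d i, Finsupp.single i a, fun j => ?_, ?_⟩
        · rw [Finsupp.single_apply]
          split_ifs with h
          · subst h
            rwa [show n + d i + 1 - d i = n + 1 by omega]
          · exact zero_mem _
        · ext j
          simp only [Finsupp.onFinset_apply, Finsupp.single_apply]
          by_cases h : i = j
          · subst h
            simp
          · simp [h]
  comp m :=
    { toFun := fun y => Finsupp.onFinset y.support
        (fun i => if d i ≤ m then s.comp (m - d i) (y i) else 0)
        (fun i hi => by
          rw [Finsupp.mem_support_iff]
          rintro h
          simp [h] at hi)
      map_zero' := by ext; simp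
      map_add' := fun y z => by
        ext i
        simp only [Finsupp.onFinset_apply, Finsupp.add_apply]
        split_ifs <;> simp }
  comp_sym {n x} m hx := by
    ext i
    have hxi := hx i
    simp only [AddMonoidHom.coe_mk, ZeroHom.coe_mk, Finsupp.onFinset_apply]
    by_cases hn : d i ≤ n
    · rw [show n + 1 - d i = (n - d i) + 1 by omega] at hxi
      rw [if_pos hn, s.comp_sym _ hxi]
      by_cases hmn : m = n
      · subst hmn; simp [hn]
      · rw [if_neg hmn]
        split_ifs
        · omega
        · rfl
        · rfl
    · by_cases hmn : m = n
      · subst hmn; simp [hn]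
      · simp [hn, hmn]
  smul_mem ha hm i := s.mul_mem_fil_sub ha (hm i)
  sym_smul {i j a m} ha hm := by
    ext k
    simp only [Finsupp.onFinset_apply, Finsupp.smul_apply, smul_eq_mul]
    have hmk := hm k
    by_cases h : d k ≤ j
    · rw [show j + 1 - d k = (j - d k) + 1 by omega] at hmk
      rw [if_pos h, if_pos (by omega), ← s.sym_mul ha hmk]
      congr 1
      omega
    · rw [show j + 1 - d k = 0 by omega] at hmk
      rw [s.eq_zero_of_mem_fil_zero hmk]
      simp

lemma free_sym_apply (n : ℕ) (x : I →₀ A) (i : I) :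
    (free s d).sym n x i = if d i ≤ n then s.sym (n - d i) (x i) else 0 := rfl

variable {M L : Type*} [AddCommGroup M] [AddCommGroup L] [Module A M] [Module R L]

/-- A family `m i` of elements of degree `d i` of a filtered module defines a filtered map from the
free filtered module, whose associated graded map is given by the symbols of the `m i`. -/
lemma linearCombination_mem (τ : ModuleSymbol s M L) (m : I → M) (hm : ∀ i, m i ∈ τ.fil (d i + 1))
    {n : ℕ} {x : I →₀ A} (hx : x ∈ (free s d).fil (n + 1)) :
    Finsupp.linearCombination A m x ∈ τ.fil (n + 1) ∧
      τ.sym n (Finsupp.linearCombination A m x) =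
        Finsupp.linearCombination R (fun i => τ.sym (d i) (m i)) ((free s d).sym n x) := by
  have key (i : I) : x i • m i ∈ τ.fil (n + 1) ∧
      τ.sym n (x i • m i) = (free s d).sym n x i • τ.sym (d i) (m i) := by
    have hxi := hx i
    rw [free_sym_apply]
    split_ifs with h
    · rw [show n + 1 - d i = (n - d i) + 1 by omega] at hxi
      have h1 := τ.smul_mem hxi (hm i)
      have h2 := τ.sym_smul hxi (hm i)
      rw [show n - d i + d i = n by omega] at h1 h2
      exact ⟨h1, h2⟩
    · rw [show n + 1 - d i = 0 by omega] at hxi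
      rw [s.eq_zero_of_mem_fil_zero hxi, zero_smul, zero_smul]
      exact ⟨zero_mem _, τ.sym_zero n⟩
  rw [Finsupp.linearCombination_apply, Finsupp.sum]
  refine ⟨sum_mem fun i _ => (key i).1, ?_⟩
  have hsupp : ((free s d).sym n x).support ⊆ x.support := fun i hi => by
    rw [Finsupp.mem_support_iff, free_sym_apply] at hi
    rw [Finsupp.mem_support_iff]
    rintro h
    simp [h] at hi
  rw [τ.sym_sum _ _ fun i _ => (key i).1, Finsupp.linearCombination_apply,
    Finsupp.sum_of_support_subset _ hsupp _ (by simp)]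
  exact Finset.sum_congr rfl fun i _ => (key i).2

end Free

section Morphisms

variable {A R : Type*} [Ring A] [Ring R] {s : RingSymbol A R}
  {Q LQ M L : Type*} [AddCommGroup Q] [AddCommGroup LQ] [Module A Q] [Module R LQ]
  [AddCommGroup M] [AddCommGroup L] [Module A M] [Module R L]

/-- `π'` is the associated graded map of the filtered map `π`. -/
def IsFiltered (ρ : ModuleSymbol s Q LQ) (τ : ModuleSymbol s M L) (π : Q →ₗ[A] M)
    (π' : LQ →ₗ[R] L) : Prop :=
  ∀ ⦃n : ℕ⦄ ⦃x : Q⦄, x ∈ ρ.fil (n + 1) → π x ∈ τ.fil (n + 1) ∧ τ.sym n (π x) = π' (ρ.sym n x)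

/-- The filtration on `M` is the image of the filtration on `Q`. -/
def IsStrict (ρ : ModuleSymbol s Q LQ) (τ : ModuleSymbol s M L) (π : Q →ₗ[A] M) : Prop :=
  ∀ ⦃n : ℕ⦄ ⦃m : M⦄, m ∈ τ.fil n → ∃ x ∈ ρ.fil n, π x = m

variable {ρ : ModuleSymbol s Q LQ} {τ : ModuleSymbol s M L} {π : Q →ₗ[A] M} {π' : LQ →ₗ[R] L}

/-- An associated graded map preserves degrees. -/
lemma IsFiltered.comp_apply (h : IsFiltered ρ τ π π') (n : ℕ) (x : LQ) :
    τ.comp n (π' x) = π' (ρ.comp n x) := by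
  induction x using ρ.induction with
  | zero => simp
  | add x y hx hy => simp only [map_add, hx, hy]
  | neg x hx => simp only [map_neg, hx]
  | sym m a ha =>
    obtain ⟨h1, h2⟩ := h ha
    rw [← h2, τ.comp_sym _ h1, ρ.comp_sym _ ha]
    split_ifs
    · exact h2
    · simp

lemma IsStrict.surjective (h : IsStrict ρ τ π) : Function.Surjective π := fun m => by
  obtain ⟨n, hn⟩ := τ.exhaustive m
  obtain ⟨x, -, hx⟩ := h hn
  exact ⟨x, hx⟩

lemma IsFiltered.surjective_of_isStrict (h : IsFiltered ρ τ π π') (h' : IsStrict ρ τ π) :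
    Function.Surjective π' := fun y => by
  induction y using τ.induction with
  | zero => exact ⟨0, map_zero _⟩
  | add x y hx hy =>
    obtain ⟨a, rfl⟩ := hx
    obtain ⟨b, rfl⟩ := hy
    exact ⟨a + b, map_add _ _ _⟩
  | neg x hx =>
    obtain ⟨a, rfl⟩ := hx
    exact ⟨-a, map_neg _ _⟩
  | sym n m hm =>
    obtain ⟨x, hx, rfl⟩ := h' hm
    exact ⟨_, (h hx).2.symm⟩

lemma IsFiltered.sym_mem_ker (h : IsFiltered ρ τ π π') {n : ℕ} {x : Q} (hx : x ∈ ρ.fil (n + 1))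
    (hπ : π x = 0) : ρ.sym n x ∈ LinearMap.ker π' := by
  rw [LinearMap.mem_ker, ← (h hx).2, hπ, τ.sym_zero]

open Classical in
/-- The kernel of a strict filtered surjection, with the induced filtration; its associated graded
module is the kernel of the associated graded map. -/
noncomputable def ker (h : IsFiltered ρ τ π π') (h' : IsStrict ρ τ π) :
    ModuleSymbol s (LinearMap.ker π) (LinearMap.ker π') where
  fil n := (ρ.fil n).comap (LinearMap.ker π).subtype.toAddMonoidHom
  mono m n hmn x hx := ρ.mono hmn hx
  fil_zero := by
    rw [eq_bot_iff]
    exact fun x hx => Subtype.ext (ρ.eq_zero_of_mem_fil_zero hx)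
  exhaustive x := ρ.exhaustive x.1
  sym n x := if hx : x.1 ∈ ρ.fil (n + 1) then ⟨ρ.sym n x.1, h.sym_mem_ker hx x.2⟩ else 0
  sym_add {n x y} hx hy := by
    have hx : x.1 ∈ ρ.fil (n + 1) := hx
    have hy : y.1 ∈ ρ.fil (n + 1) := hy
    have hxy : (x + y).1 ∈ ρ.fil (n + 1) := add_mem hx hy
    rw [dif_pos hx, dif_pos hy, dif_pos hxy]
    exact Subtype.ext (ρ.sym_add hx hy)
  sym_eq_zero_iff {n x} hx := by
    have hx : x.1 ∈ ρ.fil (n + 1) := hx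
    rw [dif_pos hx, Subtype.ext_iff]
    exact ρ.sym_eq_zero_iff hx
  closure_eq_top := by
    rw [eq_top_iff]
    rintro ⟨x, hx⟩ -
    have hcomp (n : ℕ) : ρ.comp n x ∈ LinearMap.ker π' := by
      rw [LinearMap.mem_ker, ← h.comp_apply, LinearMap.mem_ker.1 hx, map_zero]
    obtain ⟨N, hN⟩ := ρ.exists_sum_comp_eq x
    have : (⟨x, hx⟩ : LinearMap.ker π') = ∑ n ∈ Finset.range N, ⟨ρ.comp n x, hcomp n⟩ := by
      apply Subtype.ext
      rw [AddSubmonoidClass.coe_finsetSum]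
      exact hN.symm
    rw [this]
    refine sum_mem fun n _ => AddSubgroup.subset_closure ?_
    obtain ⟨q, hq, hqx⟩ := ρ.exists_sym_eq_comp n x
    -- correct the lift `q` of the component by an element of lower degree to land in the kernel
    have hπq : π q ∈ τ.fil n := by
      rw [← τ.sym_eq_zero_iff (h hq).1, (h hq).2, hqx]
      exact hcomp n
    obtain ⟨q', hq', hqq⟩ := h' hπq
    have hq'' := ρ.mono (Nat.le_succ n) hq'
    have hsub : q - q' ∈ ρ.fil (n + 1) := sub_mem hq hq''
    refine ⟨n, ⟨q - q', by rw [LinearMap.mem_ker, map_sub, hqq, sub_self]⟩, hsub, ?_⟩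
    rw [dif_pos hsub]
    apply Subtype.ext
    change ρ.sym n (q - q') = ρ.comp n x
    rw [ρ.sym_sub hq hq'', (ρ.sym_eq_zero_iff hq'').2 hq', sub_zero, hqx]
  comp n :=
    { toFun := fun x => ⟨ρ.comp n x.1, by
        rw [LinearMap.mem_ker, ← h.comp_apply, LinearMap.mem_ker.1 x.2, map_zero]⟩
      map_zero' := Subtype.ext (map_zero _)
      map_add' := fun x y => Subtype.ext (map_add _ _ _) }
  comp_sym {n x} m hx := by
    have hx : x.1 ∈ ρ.fil (n + 1) := hx
    rw [dif_pos hx]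
    apply Subtype.ext
    refine (ρ.comp_sym m hx).trans ?_
    split_ifs <;> rfl
  smul_mem ha hm := ρ.smul_mem ha hm
  sym_smul {i j a x} ha hx := by
    have hx : x.1 ∈ ρ.fil (j + 1) := hx
    have hax : (a • x).1 ∈ ρ.fil (i + j + 1) := ρ.smul_mem ha hx
    rw [dif_pos hx, dif_pos hax]
    exact Subtype.ext (ρ.sym_smul ha hx)

end Morphisms

section Projective

variable {A R : Type*} [Ring A] [Ring R] {s : RingSymbol A R}
  {M L : Type*} [AddCommGroup M] [AddCommGroup L] [Module A M] [Module R L]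

/-- Let `π : Q → M` be surjective and `f` an endomorphism of `Q` over `M` which is locally nilpotent
on the kernel of `π`. Then the powers of `f` stabilise on every element and their limit defines a
section of `π`. -/
lemma exists_section_of_locally_nilpotent {A Q M : Type*} [Ring A] [AddCommGroup Q] [Module A Q]
    [AddCommGroup M] [Module A M] (π : Q →ₗ[A] M) (hπ : Function.Surjective π) (f : Q →ₗ[A] Q)
    (hf : ∀ x, π (f x) = π x) (hnil : ∀ x, π x = 0 → ∃ k, (f ^ k) x = 0) :
    ∃ t : M →ₗ[A] Q, π ∘ₗ t = LinearMap.id := by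
  let lim (x y : Q) : Prop := ∃ k, ∀ j ≥ k, (f ^ j) x = y
  have hpow (k : ℕ) (x : Q) : π ((f ^ k) x) = π x := by
    induction k with
    | zero => rfl
    | succ k ih => rw [pow_succ', Module.End.mul_apply, hf, ih]
  have hzero {x : Q} (hx : π x = 0) : lim x 0 := by
    obtain ⟨k, hk⟩ := hnil x hx
    refine ⟨k, fun j hj => ?_⟩
    obtain ⟨i, rfl⟩ := Nat.exists_eq_add_of_le' hj
    rw [pow_add, Module.End.mul_apply, hk, map_zero]
  have hadd {x x' y y' : Q} (h : lim x y) (h' : lim x' y') : lim (x + x') (y + y') := by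
    obtain ⟨k, hk⟩ := h
    obtain ⟨k', hk'⟩ := h'
    exact ⟨max k k', fun j hj => by
      rw [map_add, hk j (le_trans (le_max_left _ _) hj), hk' j (le_trans (le_max_right _ _) hj)]⟩
  have hsmul (a : A) {x y : Q} (h : lim x y) : lim (a • x) (a • y) :=
    h.imp fun k hk j hj => by rw [map_smul, hk j hj]
  have huniq {x y y' : Q} (h : lim x y) (h' : lim x y') : y = y' := by
    obtain ⟨k, hk⟩ := h
    obtain ⟨k', hk'⟩ := h'
    rw [← hk (max k k') (le_max_left _ _), hk' (max k k') (le_max_right _ _)]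
  have hex (x : Q) : ∃ y, lim x y := by
    -- `f x - x` lies in the kernel of `π`, hence is killed by a power of `f`
    obtain ⟨k, hk⟩ := hzero (x := f x - x) (by rw [map_sub, hf, sub_self])
    refine ⟨(f ^ k) x, k, fun j hj => ?_⟩
    induction j, hj using Nat.le_induction with
    | base => rfl
    | succ j hj ih =>
      rw [← ih, ← sub_eq_zero, pow_succ, Module.End.mul_apply, ← map_sub]
      exact hk j hj
  have hproj {x y : Q} (h : lim x y) : π y = π x := by
    obtain ⟨k, hk⟩ := h
    rw [← hk k le_rfl, hpow]
  have hcongr {x x' y y' : Q} (hx : π x = π x') (h : lim x y) (h' : lim x' y') : y = y' := by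
    have h1 := hadd h' (hzero (x := x - x') (by rw [map_sub, hx, sub_self]))
    rw [add_sub_cancel, add_zero] at h1
    exact huniq h h1
  choose g hg using hπ
  choose l hl using hex
  refine ⟨{ toFun := fun m => l (g m), map_add' := fun a b => ?_, map_smul' := fun a m => ?_ }, ?_⟩
  · exact hcongr (by rw [map_add, hg, hg, hg]) (hl _) (hadd (hl _) (hl _))
  · exact hcongr (by rw [map_smul, hg, hg]) (hl _) (hsmul a (hl _))
  · ext m
    exact (hproj (hl (g m))).trans (hg m)

/-- The index type of the canonical free cover of a filtered module: the pairs of a degree and an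
element of at most that degree. -/
abbrev CoverIndex (τ : ModuleSymbol s M L) : Type _ := {p : ℕ × M // p.2 ∈ τ.fil (p.1 + 1)}

variable (τ : ModuleSymbol s M L)

/-- The free filtered module on all elements of `M` of all possible degrees. -/
noncomputable abbrev cover : ModuleSymbol s (CoverIndex τ →₀ A) (CoverIndex τ →₀ R) :=
  free s fun i : CoverIndex τ => i.1.1

/-- The map from the canonical free cover. -/
noncomputable abbrev coverMap : (CoverIndex τ →₀ A) →ₗ[A] M :=
  Finsupp.linearCombination A fun i => i.1.2

/-- The associated graded map of `coverMap`. -/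
noncomputable abbrev grCoverMap : (CoverIndex τ →₀ R) →ₗ[R] L :=
  Finsupp.linearCombination R fun i => τ.sym i.1.1 i.1.2

lemma isFiltered_coverMap : IsFiltered τ.cover τ τ.coverMap τ.grCoverMap := fun _ _ hx =>
  linearCombination_mem s _ τ _ (fun i => i.2) hx

lemma isStrict_coverMap : IsStrict τ.cover τ τ.coverMap := by
  classical
  intro n m hm
  obtain _ | n := n
  · exact ⟨0, zero_mem _, by rw [τ.eq_zero_of_mem_fil_zero hm, map_zero]⟩
  · refine ⟨Finsupp.single ⟨(n, m), hm⟩ 1, fun i => ?_, by simp⟩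
    rw [Finsupp.single_apply]
    split_ifs with h
    · subst h
      rw [show n + 1 - n = 1 by omega]
      exact s.one_mem
    · exact zero_mem _

/-- A filtered module is projective if its associated graded module is. The component of degree zero
of a splitting of the graded cover lifts to an endomorphism of the cover that lowers the filtration
on the kernel. -/
theorem projective (τ : ModuleSymbol s M L) (h : Module.Projective R L) : Module.Projective A M := by
  have hfil := τ.isFiltered_coverMap
  have hstr := τ.isStrict_coverMap
  obtain ⟨t, ht⟩ := τ.grCoverMap.exists_rightInverse_of_surjective
    (LinearMap.range_eq_top.2 (hfil.surjective_of_isStrict hstr))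
  have ht' (x : L) : τ.grCoverMap (t x) = x := LinearMap.congr_fun ht x
  -- images of the generators: lifts of the degree-preserving part of the splitting, corrected by
  -- elements of lower degree so that the endomorphism is one over `M`
  have hlift (i : CoverIndex τ) : ∃ y ∈ τ.cover.fil (i.1.1 + 1), τ.coverMap y = i.1.2 ∧
      τ.cover.sym i.1.1 y = τ.cover.comp i.1.1 (t (τ.sym i.1.1 i.1.2)) := by
    obtain ⟨y, hy, hyt⟩ := τ.cover.exists_sym_eq_comp i.1.1 (t (τ.sym i.1.1 i.1.2))
    have h1 : τ.sym i.1.1 i.1.2 = τ.sym i.1.1 (τ.coverMap y) := by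
      rw [(hfil hy).2, hyt, ← hfil.comp_apply, ht', τ.comp_sym_self i.2]
    rw [τ.sym_eq_iff i.2 (hfil hy).1] at h1
    obtain ⟨z, hz, hzm⟩ := hstr h1
    have hz' := τ.cover.mono (Nat.le_succ _) hz
    refine ⟨y + z, add_mem hy hz', ?_, ?_⟩
    · rw [map_add, hzm, add_sub_cancel]
    · rw [τ.cover.sym_add hy hz', (τ.cover.sym_eq_zero_iff hz').2 hz, add_zero, hyt]
  choose y hy hym hyt using hlift
  let f : (CoverIndex τ →₀ A) →ₗ[A] (CoverIndex τ →₀ A) := Finsupp.linearCombination A y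
  have hf (x) : τ.coverMap (f x) = τ.coverMap x := by
    have : τ.coverMap ∘ₗ f = τ.coverMap := by
      ext i
      simp [f, hym]
    exact LinearMap.congr_fun this x
  have hfsym {n : ℕ} {x} (hx : x ∈ τ.cover.fil (n + 1)) : f x ∈ τ.cover.fil (n + 1) ∧
      τ.cover.sym n (f x) = τ.cover.comp n (t (τ.sym n (τ.coverMap x))) := by
    obtain ⟨h1, h2⟩ := linearCombination_mem s _ τ.cover y hy hx
    refine ⟨h1, h2.trans ?_⟩
    rw [(hfil hx).2, Finsupp.linearCombination_apply, Finsupp.linearCombination_apply, Finsupp.sum,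
      Finsupp.sum, map_sum, map_sum]
    refine Finset.sum_congr rfl fun i _ => ?_
    rw [map_smul, hyt, free_sym_apply]
    have hxi := hx i
    dsimp only at hxi
    split_ifs with hi
    · rw [show n + 1 - i.1.1 = (n - i.1.1) + 1 by omega] at hxi
      rw [τ.cover.comp_sym_smul hxi, if_pos (by omega), show n - (n - i.1.1) = i.1.1 by omega]
    · simp
  -- the symbol of `f x` is determined by that of the image of `x` in `M`, so `f` lowers the
  -- filtration on the kernel
  have hnil (n : ℕ) : ∀ x ∈ τ.cover.fil n, τ.coverMap x = 0 → (f ^ n) x = 0 := by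
    induction n with
    | zero => exact fun x hx _ => τ.cover.eq_zero_of_mem_fil_zero hx
    | succ n ih =>
      intro x hx h0
      rw [pow_succ, Module.End.mul_apply]
      obtain ⟨h1, h2⟩ := hfsym hx
      rw [h0, τ.sym_zero, map_zero, map_zero] at h2
      exact ih _ ((τ.cover.sym_eq_zero_iff h1).1 h2) (by rw [hf, h0])
  obtain ⟨g, hg⟩ := exists_section_of_locally_nilpotent τ.coverMap hstr.surjective f hf
    fun x hx => by
    obtain ⟨n, hn⟩ := τ.cover.exhaustive x
    exact ⟨n, hnil n x hn hx⟩
  exact Module.Projective.of_split g τ.coverMap hg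

end Projective

/-- The projective dimension of a filtered module is at most that of its associated graded
module. -/
theorem projDimLE {A R : Type u} [Ring A] [Ring R] {s : RingSymbol A R} (n : ℕ) :
    ∀ {M L : Type u} [AddCommGroup M] [AddCommGroup L] [Module A M] [Module R L]
      (_ : ModuleSymbol s M L), ProjDimLE R L n → ProjDimLE A M n := by
  induction n with
  | zero =>
    intro M L _ _ _ _ τ h
    rw [projDimLE_zero_iff] at h ⊢
    exact τ.projective h
  | succ n ih =>
    intro M L _ _ _ _ τ h
    have hfil := τ.isFiltered_coverMap
    have hstr := τ.isStrict_coverMap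
    rw [projDimLE_succ_iff τ.grCoverMap (hfil.surjective_of_isStrict hstr)] at h
    rw [projDimLE_succ_iff τ.coverMap hstr.surjective]
    exact ih (ker hfil hstr) h

end ModuleSymbol

/-- The global dimension of a filtered ring is at most that of its associated graded ring. -/
theorem RingSymbol.leftGlobalDimensionLE {A R : Type u} [Ring A] [Ring R] (s : RingSymbol A R)
    {n : ℕ} (h : LeftGlobalDimensionLE R n) : LeftGlobalDimensionLE A n := fun M =>
  letI : Module R M := Module.compHom M (s.augmentation)
  (ModuleSymbol.trivial s M).projDimLE n (h.projDimLE M)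

end FilteredModules

/-! ### The associated graded algebra of an algebra filtration -/

section AssociatedGraded

namespace AlgFiltration

variable {k A : Type*} [CommRing k] [Ring A] [Algebra k A] (𝓕 : AlgFiltration k A)

lemma cls_eq_zero_iff {n : ℕ} {a : A} (ha : a ∈ 𝓕.F n) : 𝓕.cls a ha = 0 ↔ a ∈ 𝓕.prev n :=
  Submodule.Quotient.mk_eq_zero _

open Classical in
/-- A ring with an exhaustive filtration, with its associated graded algebra `⨁ n, F n / F (n - 1)`
as model of the associated graded ring. -/
noncomputable def ringSymbol (hex : ∀ a, ∃ n, a ∈ 𝓕.F n) : RingSymbol A 𝓕.Gr where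
  fil n := (𝓕.prev n).toAddSubgroup
  mono := monotone_nat_of_le_succ fun n => by
    obtain _ | n := n
    · exact fun x hx => by rw [show x = 0 from hx]; exact zero_mem _
    · exact 𝓕.mono (Nat.le_succ n)
  fil_zero := rfl
  exhaustive a := (hex a).elim fun n hn => ⟨n + 1, hn⟩
  sym n a := if ha : a ∈ 𝓕.F n then DirectSum.of 𝓕.Piece n (𝓕.cls a ha) else 0
  sym_add {n a b} ha hb := by
    have ha : a ∈ 𝓕.F n := ha
    have hb : b ∈ 𝓕.F n := hb
    rw [dif_pos ha, dif_pos hb, dif_pos (add_mem ha hb), ← map_add, cls_add]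
  sym_eq_zero_iff {n a} ha := by
    have ha : a ∈ 𝓕.F n := ha
    rw [dif_pos ha, map_eq_zero_iff _ (DirectSum.of_injective n), cls_eq_zero_iff]
    rfl
  closure_eq_top := by
    rw [eq_top_iff]
    rintro x -
    induction x using DirectSum.induction_on with
    | zero => exact zero_mem _
    | add x y hx hy => exact add_mem hx hy
    | of n x =>
      obtain ⟨a, ha, rfl⟩ := exists_cls x
      exact AddSubgroup.subset_closure ⟨n, a, ha, dif_pos ha⟩
  comp n := (DirectSum.of 𝓕.Piece n).comp (DFinsupp.evalAddMonoidHom n)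
  comp_sym {n a} m ha := by
    have ha : a ∈ 𝓕.F n := ha
    rw [dif_pos ha]
    change DirectSum.of 𝓕.Piece m (DirectSum.of 𝓕.Piece n (𝓕.cls a ha) m) = _
    split_ifs with h
    · subst h
      rw [DirectSum.of_eq_same]
    · rw [DirectSum.of_eq_of_ne _ _ _ h, map_zero]
  one_mem := 𝓕.one_mem
  mul_mem ha hb := 𝓕.mul_mem ha hb
  sym_one := dif_pos 𝓕.one_mem
  sym_mul {i j a b} ha hb := by
    have ha : a ∈ 𝓕.F i := ha
    have hb : b ∈ 𝓕.F j := hb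
    rw [dif_pos ha, dif_pos hb, dif_pos (𝓕.mul_mem ha hb), DirectSum.of_mul_of]
    rfl

end AlgFiltration

end AssociatedGraded

/-! ### Graded Hecke algebras -/

section GradedHeckeAlgebra

namespace GradedHecke

variable {V : Type u} [AddCommGroup V] [Module ℂ V]
  {G : Subgroup (LinearMap.GeneralLinearGroup ℂ V)}

/-- The filtration of `A` is exhaustive, as `A` is generated by `V` and `ℂ G`. -/
lemma exists_mem_filtration (κ : V →ₗ[ℂ] V →ₗ[ℂ] MonoidAlgebra ℂ G) (a : Alg κ) :
    ∃ n, a ∈ (filtration κ).F n := by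
  let 𝓕 := filtration κ
  have hadd {a b : Alg κ} (ha : ∃ n, a ∈ 𝓕.F n) (hb : ∃ n, b ∈ 𝓕.F n) :
      ∃ n, a + b ∈ 𝓕.F n := by
    obtain ⟨i, hi⟩ := ha
    obtain ⟨j, hj⟩ := hb
    exact ⟨max i j, add_mem (𝓕.mono (le_max_left i j) hi) (𝓕.mono (le_max_right i j) hj)⟩
  have hmul {a b : Alg κ} (ha : ∃ n, a ∈ 𝓕.F n) (hb : ∃ n, b ∈ 𝓕.F n) :
      ∃ n, a * b ∈ 𝓕.F n := by
    obtain ⟨i, hi⟩ := ha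
    obtain ⟨j, hj⟩ := hb
    exact ⟨i + j, 𝓕.mul_mem hi hj⟩
  have hgroup (x : MonoidAlgebra ℂ G) : ∃ n, RingQuot.mkAlgHom ℂ (Rel κ) (groupIncl x) ∈ 𝓕.F n :=
    ⟨0, x, rfl⟩
  have hvec (v : V) : ∃ n, RingQuot.mkAlgHom ℂ (Rel κ) (vecIncl v) ∈ 𝓕.F n := by
    refine ⟨1, ?_⟩
    change _ ∈ (groupPart κ ⊔ vecPart κ * groupPart κ) ^ 1
    rw [pow_one]
    refine Submodule.mem_sup_right ?_
    rw [← mul_one (RingQuot.mkAlgHom ℂ (Rel κ) (vecIncl v))]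
    exact Submodule.mul_mem_mul ⟨v, rfl⟩ (Submodule.one_le.1 (one_le_groupPart κ))
  have htensor (t : TensorAlgebra ℂ V) :
      ∃ n, RingQuot.mkAlgHom ℂ (Rel κ) (SkewMonoidAlgebra.single 1 t) ∈ 𝓕.F n := by
    induction t using TensorAlgebra.induction with
    | algebraMap r =>
      have : (SkewMonoidAlgebra.single 1 (algebraMap ℂ _ r) : TensorSkew G) =
        algebraMap ℂ (TensorSkew G) r := rfl
      rw [this, AlgHom.commutes]
      exact ⟨0, AlgFiltration.algebraMap_mem r⟩
    | ι v => exact hvec v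
    | mul a b ha hb =>
      have : (SkewMonoidAlgebra.single 1 (a * b) : TensorSkew G) =
        SkewMonoidAlgebra.single 1 a * SkewMonoidAlgebra.single 1 b :=
          map_mul SkewMonoidAlgebra.singleOneRingHom a b
      rw [this, map_mul]
      exact hmul ha hb
    | add a b ha hb =>
      rw [SkewMonoidAlgebra.single_add, map_add]
      exact hadd ha hb
  obtain ⟨x, rfl⟩ := RingQuot.mkAlgHom_surjective ℂ (Rel κ) a
  induction x using SkewMonoidAlgebra.induction_on with
  | zero => exact ⟨0, by rw [map_zero]; exact zero_mem _⟩
  | add x y hx hy =>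
    rw [map_add]
    exact hadd hx hy
  | single g t =>
    have : (SkewMonoidAlgebra.single g t : TensorSkew G) =
        SkewMonoidAlgebra.single 1 t * groupIncl (MonoidAlgebra.of ℂ G g) := by
      simp [groupIncl, SkewMonoidAlgebra.single_mul_single]
    rw [this, map_mul]
    exact hmul (htensor t) (hgroup _)

/-- A vector killed by `ι` is killed by every linear form, as linear forms extend to `S(V)`. -/
lemma symmetricAlgebra_ι_injective : Function.Injective (SymmetricAlgebra.ι ℂ V) := by
  rw [injective_iff_map_eq_zero]
  intro v hv
  rw [← Module.forall_dual_apply_eq_zero_iff ℂ]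
  intro f
  have h := congrArg (SymmetricAlgebra.lift f) hv
  rwa [SymmetricAlgebra.lift_ι_apply, map_zero] at h

/-- `G` acts faithfully on `V`, hence on `S(V)`. -/
instance : FaithfulSMul G (SymmetricAlgebra ℂ V) where
  eq_of_smul_eq_smul {g h} hgh := by
    apply Subtype.ext
    apply Units.ext
    ext v
    have h1 (k : G) : k • SymmetricAlgebra.ι ℂ V v = SymmetricAlgebra.ι ℂ V (toEnd G k v) := by
      change symHom G k (SymmetricAlgebra.ι ℂ V v) = _
      simp [symHom]
    have h2 := hgh (SymmetricAlgebra.ι ℂ V v)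
    rw [h1, h1] at h2
    exact symmetricAlgebra_ι_injective h2

end GradedHecke

end GradedHeckeAlgebra

theorem mainTheorem9 {V : Type*} [AddCommGroup V] [Module ℂ V] [FiniteDimensional ℂ V]
    (G : Subgroup (LinearMap.GeneralLinearGroup ℂ V)) [Finite G]
    (κ : V →ₗ[ℂ] V →ₗ[ℂ] MonoidAlgebra ℂ G)
    (hκ : ∀ v w : V, κ v w = -κ w v)
    (hA : GradedHecke.IsGradedHecke κ) :
    IsTwoSidedNoetherian (GradedHecke.Alg κ) ∧
      IsPrimeRing (GradedHecke.Alg κ) ∧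
      HasFiniteGlobalDimension (GradedHecke.Alg κ) := by
  obtain ⟨φ, -⟩ := hA
  let e : GradedHecke.SymSkew G ≃+* (GradedHecke.filtration κ).Gr := φ.toRingEquiv
  let eop : GradedHecke.SymSkew G ≃+* ((GradedHecke.filtration κ).Gr)ᵐᵒᵖ :=
    SkewMonoidAlgebra.opRingEquiv.trans e.op
  let s : RingSymbol (GradedHecke.Alg κ) (GradedHecke.filtration κ).Gr :=
    (GradedHecke.filtration κ).ringSymbol (GradedHecke.exists_mem_filtration κ)
  have hS : IsNoetherianRing (SymmetricAlgebra ℂ V) :=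
    isNoetherianRing_of_ringEquiv _
      (SymmetricAlgebra.equivMvPolynomial (Module.finBasis ℂ V)).symm.toRingEquiv
  have hnoeth : IsNoetherianRing (GradedHecke.SymSkew G) := SkewMonoidAlgebra.isNoetherianRing
  have hcard : IsUnit (Nat.card G : SymmetricAlgebra ℂ V) := by
    have h : IsUnit (Nat.card G : ℂ) := (Nat.cast_ne_zero.2 Nat.card_pos.ne').isUnit
    simpa using h.map (algebraMap ℂ (SymmetricAlgebra ℂ V))
  have hdim : LeftGlobalDimensionLE (GradedHecke.SymSkew G) (Module.finrank ℂ V) :=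
    (leftGlobalDimensionLE_symmetricAlgebra ℂ V).skewMonoidAlgebra hcard
  exact ⟨⟨s.isNoetherianRing (isNoetherianRing_of_ringEquiv _ e),
      s.op.isNoetherianRing (isNoetherianRing_of_ringEquiv _ eop)⟩,
    s.isPrimeRing (SkewMonoidAlgebra.isPrimeRing.of_ringEquiv e),
    HasFiniteGlobalDimension.of_le (s.leftGlobalDimensionLE (hdim.of_ringEquiv e))
      (s.op.leftGlobalDimensionLE (hdim.of_ringEquiv eop))⟩
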